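/- Let $\mathbb{k}$ be a field and let $S=\mathbb{k}[y]$ be the $\mathbb{Z}$-graded polynomial ring with $y$ in degree $1$. Let $\mathrm{gr}\,S$ be the abelian category of finitely generated $\mathbb{Z}$-graded $S$-modules and degree-preserving $S$-linear maps, with twist $M(j)_i=M_{i+j}$. Let $\mathsf{D}^{\mathrm b}(\mathrm{gr}\,S)$ be its bounded derived category, with suspension $\Sigma$, and let $\mathsf{D}^{\mathrm b}_{\mathrm{tors}}(\mathrm{gr}\,S)$ be the full triangulated subcategory of complexes whose total cohomology has finite length. For a triangulated category $\mathsf{T}$, let $\mathrm{Thick}(\mathsf{T})$ be the complete lattice, under inclusion, of thick subcategories of $\mathsf{T}$, i.e. full replete triangulated subcategories closed under direct summands. An arc is a pair $(a,b)$ with $a,b\in\mathbb{Z}\sqcup\{-\infty\}$ and $a<b$. Let $\mathcal{A}$ be the set of arcs and $\mathcal{A}_f$ the set of arcs with $a\in\mathbb{Z}$. Put $M_{(-\infty,b)}=S(b)$ and $M_{(a,b)}=\bigl(S/(y^{b-a})\bigr)(b)$ for $a\in\mathbb{Z}$, viewed in $\mathsf{D}^{\mathrm b}(\mathrm{gr}\,S)$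 as stalk complexes in degree $0$. A set $\mathcal{S}$ of arcs is saturated if whenever $(a,b),(c,d)\in\mathcal{S}$ and $a\le c\le b\le d$, those of $(a,c),(c,b),(b,d),(a,d)$ that are arcs lie in $\mathcal{S}$. Let $\mathrm{Sat}(\mathcal{A})$ and $\mathrm{Sat}(\mathcal{A}_f)$ be the complete lattices, under inclusion, of saturated subsets of $\mathcal{A}$ and of $\mathcal{A}_f$. For a set $\mathcal{S}$ of arcs let $\tau(\mathcal{S})=\mathrm{add}\{\Sigma^l M_{(a,b)}\mid l\in\mathbb{Z},\ (a,b)\in\mathcal{S}\}$ be the full subcategory of direct summands of finite direct sums of the objects listed, and for a full subcategory $\mathsf{M}$ of $\mathsf{D}^{\mathrm b}(\mathrm{gr}\,S)$ let $\sigma(\mathsf{M})=\{(a,b)\in\mathcal{A}\mid M_{(a,b)}\in\mathsf{M}\}$. Theorem. If $\mathcal{S}$ is saturated then $\tau(\mathcal{S})$ is thick, and if $\mathsf{M}$ is thick then $\sigma(\mathsf{M})$ is saturated. The maps $\tau$ and $\sigma$ are mutually inverse lattice isomorphisms $$\mathrm{Sat}(\mathcal{A})\cong\mathrm{Thick}(\mathsf{D}^{\mathrm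 b}(\mathrm{gr}\,S)),$$ and they restrict to mutually inverse lattice isomorphisms $$\mathrm{Sat}(\mathcal{A}_f)\cong\mathrm{Thick}(\mathsf{D}^{\mathrm b}_{\mathrm{tors}}(\mathrm{gr}\,S)),$$ where a thick subcategory of $\mathsf{D}^{\mathrm b}_{\mathrm{tors}}(\mathrm{gr}\,S)$ is identified with its essential image in $\mathsf{D}^{\mathrm b}(\mathrm{gr}\,S)$. -/

import Mathlib

open CategoryTheory CategoryTheory.Limits CategoryTheory.Pretriangulated
open scoped Polynomial

universe u v

noncomputable section

namespace ArcModel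

/-! ### Graded `S`-modules, where `S = k[y]` with `y` in degree `1` -/

section Gradings

variable {M : Type u} [AddCommGroup M]

/-- A family of subgroups is an internal direct sum decomposition as soon as it admits
a compatible family of projections. -/
theorem isInternal_of_proj (𝓜 : ℤ → AddSubgroup M) (p : ℤ → M →+ M)
    (h₁ : ∀ i m, p i m ∈ 𝓜 i) (h₂ : ∀ i, ∀ m ∈ 𝓜 i, p i m = m)
    (h₃ : ∀ i j, i ≠ j → ∀ m ∈ 𝓜 i, p j m = 0)
    (h₄ : ∀ m, ∃ s : Finset ℤ, ∑ i ∈ s, p i m = m) :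
    DirectSum.IsInternal 𝓜 := by
  classical
  constructor
  · rw [injective_iff_map_eq_zero]
    intro x hx
    have key : ∀ (j : ℤ) (x : DirectSum ℤ fun i ↦ 𝓜 i),
        p j (DirectSum.coeAddMonoidHom 𝓜 x) = x j := by
      intro j x
      induction x using DirectSum.induction_on with
      | zero => simp
      | of i m =>
        rw [DirectSum.coeAddMonoidHom_of]
        by_cases hij : i = j
        · subst hij
          rw [h₂ _ _ m.2, DirectSum.of_eq_same]
        · rw [h₃ i j hij _ m.2, DirectSum.of_eq_of_ne _ _ _ (Ne.symm hij)]
          rfl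
      | add x y hx hy => simp [hx, hy]
    ext j
    rw [← key j x, hx]
    simp
  · intro m
    obtain ⟨s, hs⟩ := h₄ m
    refine ⟨∑ i ∈ s, DirectSum.of (fun i ↦ 𝓜 i) i ⟨p i m, h₁ i m⟩, ?_⟩
    rw [map_sum]
    simp only [DirectSum.coeAddMonoidHom_of]
    exact hs

/-- The projection onto the `i`-th summand of an internal direct sum decomposition. -/
def proj {𝓜 : ℤ → AddSubgroup M} (h : DirectSum.IsInternal 𝓜) (i : ℤ) : M →+ M :=
  letI := h.chooseDecomposition
  ((𝓜 i).subtype.comp (DFinsupp.evalAddMonoidHom i)).comp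
    (DirectSum.decomposeAddEquiv 𝓜).toAddMonoidHom

variable {𝓜 : ℤ → AddSubgroup M} (h : DirectSum.IsInternal 𝓜)

theorem proj_mem (i : ℤ) (m : M) : proj h i m ∈ 𝓜 i := by
  simp [proj]

theorem proj_same {i : ℤ} {m : M} (hm : m ∈ 𝓜 i) : proj h i m = m := by
  let := h.chooseDecomposition
  exact DirectSum.decompose_of_mem_same 𝓜 hm

theorem proj_ne {i j : ℤ} (hij : i ≠ j) {m : M} (hm : m ∈ 𝓜 i) : proj h j m = 0 := by
  let := h.chooseDecomposition
  exact DirectSum.decompose_of_mem_ne 𝓜 hm hij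

theorem exists_sum_proj (m : M) : ∃ s : Finset ℤ, ∑ i ∈ s, proj h i m = m := by
  classical
  let := h.chooseDecomposition
  exact ⟨_, DirectSum.sum_support_decompose 𝓜 m⟩

theorem mem_of_proj {i : ℤ} {m : M} (hm : ∀ j, j ≠ i → proj h j m = 0) : m ∈ 𝓜 i := by
  classical
  obtain ⟨s, hs⟩ := exists_sum_proj h m
  rw [← hs]
  refine AddSubgroup.sum_mem _ fun j _ ↦ ?_
  by_cases hj : j = i
  · subst hj; exact proj_mem h _ m
  · rw [hm j hj]; exact zero_mem _

theorem proj_map {N : Type u} [AddCommGroup N] {𝓝 : ℤ → AddSubgroup N}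
    (h' : DirectSum.IsInternal 𝓝) (f : M →+ N) (hf : ∀ i, ∀ m ∈ 𝓜 i, f m ∈ 𝓝 i)
    (i : ℤ) (m : M) : proj h' i (f m) = f (proj h i m) := by
  classical
  obtain ⟨s, hs⟩ := exists_sum_proj h m
  have key : ∀ j, proj h' i (f (proj h j m)) = f (proj h i (proj h j m)) := by
    intro j
    by_cases hj : j = i
    · subst hj
      rw [proj_same h' (hf _ _ (proj_mem h _ m)), proj_same h (proj_mem h _ m)]
    · rw [proj_ne h' hj (hf _ _ (proj_mem h _ m)), proj_ne h hj (proj_mem h _ m), map_zero]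
  rw [← hs]
  simp only [map_sum, key]

end Gradings

variable (k : Type u) [Field k]

/-- The homogeneous polynomials of degree `i ∈ ℤ` in `S = k[y]`, where `y` has degree `1`;
thus `S_i = k y^i` for `i ≥ 0` and `S_i = 0` for `i < 0`. -/
def homogeneous (i : ℤ) : AddSubgroup k[X] where
  carrier := {f | ∀ n : ℕ, f.coeff n ≠ 0 → (n : ℤ) = i}
  zero_mem' := by simp
  add_mem' := by
    intro f g hf hg n hn
    by_contra hne
    apply hn
    rw [Polynomial.coeff_add, not_not.1 fun h ↦ hne (hf n h), not_not.1 fun h ↦ hne (hg n h),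
      add_zero]
  neg_mem' := by
    intro f hf n hn
    exact hf n (by simpa using hn)

variable {k} in
theorem mem_homogeneous {i : ℤ} {f : k[X]} :
    f ∈ homogeneous k i ↔ ∀ n : ℕ, f.coeff n ≠ 0 → (n : ℤ) = i := Iff.rfl

theorem homogeneous_mul {i j : ℤ} {f g : k[X]} (hf : f ∈ homogeneous k i)
    (hg : g ∈ homogeneous k j) : f * g ∈ homogeneous k (i + j) := by
  intro n hn
  rw [Polynomial.coeff_mul] at hn
  obtain ⟨⟨a, b⟩, hab, hne⟩ := Finset.exists_ne_zero_of_sum_ne_zero hn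
  have h1 := hf a (left_ne_zero_of_mul hne)
  have h2 := hg b (right_ne_zero_of_mul hne)
  have h3 : a + b = n := Finset.HasAntidiagonal.mem_antidiagonal.1 hab
  lia

/-- The projection of a polynomial to its component of degree `i`. -/
def homogeneousProj (i : ℤ) : k[X] →+ k[X] where
  toFun f := if 0 ≤ i then Polynomial.monomial i.toNat (f.coeff i.toNat) else 0
  map_zero' := by simp
  map_add' f g := by split_ifs <;> simp

theorem isInternal_homogeneous : DirectSum.IsInternal (homogeneous k) := by
  refine isInternal_of_proj _ (homogeneousProj k) ?_ ?_ ?_ ?_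
  · intro i f n hn
    by_cases hi : 0 ≤ i
    · simp only [homogeneousProj, AddMonoidHom.coe_mk, ZeroHom.coe_mk, if_pos hi,
        Polynomial.coeff_monomial] at hn
      have : i.toNat = n := by
        by_contra hne
        exact hn (if_neg hne)
      lia
    · simp [homogeneousProj, if_neg hi] at hn
  · intro i f hf
    ext n
    by_cases hi : 0 ≤ i
    · simp only [homogeneousProj, AddMonoidHom.coe_mk, ZeroHom.coe_mk, if_pos hi,
        Polynomial.coeff_monomial]
      split_ifs with hn
      · rw [hn]
      · by_contra hne
        have := hf n (Ne.symm hne)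
        lia
    · simp only [homogeneousProj, AddMonoidHom.coe_mk, ZeroHom.coe_mk, if_neg hi]
      by_contra hne
      have := hf n (by simpa using Ne.symm hne)
      lia
  · intro i j hij f hf
    by_cases hj : 0 ≤ j
    · simp only [homogeneousProj, AddMonoidHom.coe_mk, ZeroHom.coe_mk, if_pos hj]
      by_contra hne
      have := hf j.toNat (by simpa using hne)
      lia
    · simp [homogeneousProj, if_neg hj]
  · intro f
    refine ⟨f.support.map Nat.castEmbedding, ?_⟩
    rw [Finset.sum_map]
    simp only [homogeneousProj, AddMonoidHom.coe_mk, ZeroHom.coe_mk, Nat.castEmbedding_apply,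
      Nat.cast_nonneg, if_true, Int.toNat_natCast]
    exact f.as_sum_support.symm

/-- The objects of `gr S`: finitely generated `ℤ`-graded modules over `S = k[y]`, `|y| = 1`.
As `S` is noetherian, these are the finitely presented graded modules. -/
structure GrMod where
  /-- the underlying `S`-module -/
  carrier : Type u
  [addCommGroup : AddCommGroup carrier]
  [module : Module k[X] carrier]
  [finite : Module.Finite k[X] carrier]
  /-- the homogeneous elements of degree `i` -/
  grading : ℤ → AddSubgroup carrier
  isInternal : DirectSum.IsInternal grading
  smul_mem : ∀ (i j : ℤ), ∀ f ∈ homogeneous k i, ∀ m ∈ grading j, f • m ∈ grading (i + j)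

namespace GrMod

attribute [instance] addCommGroup module finite

variable {k}

instance : CoeSort (GrMod k) (Type u) := ⟨carrier⟩

/-- The degree preserving `S`-linear maps between two graded `S`-modules. -/
def homs (M N : GrMod k) : AddSubgroup (M →ₗ[k[X]] N) where
  carrier := {f | ∀ i, ∀ m ∈ M.grading i, f m ∈ N.grading i}
  zero_mem' := fun i _ _ ↦ zero_mem (N.grading i)
  add_mem' := fun hf hg i m hm ↦ add_mem (hf i m hm) (hg i m hm)
  neg_mem' := fun hf i m hm ↦ neg_mem (hf i m hm)

/-- The category `gr S`. -/
instance : Category (GrMod k) where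
  Hom M N := homs M N
  id M := ⟨LinearMap.id, fun _ _ hm ↦ hm⟩
  comp f g := ⟨g.1.comp f.1, fun i m hm ↦ g.2 i _ (f.2 i m hm)⟩

/-- The linear map underlying a morphism of `gr S`. -/
def toLin {M N : GrMod k} (f : M ⟶ N) : M →ₗ[k[X]] N := Subtype.val f

/-- A morphism of `gr S` from a degree preserving linear map. -/
def ofLin {M N : GrMod k} (f : M →ₗ[k[X]] N) (hf : ∀ i, ∀ m ∈ M.grading i, f m ∈ N.grading i) :
    M ⟶ N := ⟨f, hf⟩

theorem toLin_mem {M N : GrMod k} (f : M ⟶ N) {i : ℤ} {m : M} (hm : m ∈ M.grading i) :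
    toLin f m ∈ N.grading i := f.2 i m hm

@[simp] theorem toLin_ofLin {M N : GrMod k} (f : M →ₗ[k[X]] N)
    (hf : ∀ i, ∀ m ∈ M.grading i, f m ∈ N.grading i) : toLin (ofLin f hf) = f := rfl

@[ext] theorem hom_ext {M N : GrMod k} {f g : M ⟶ N} (h : ∀ m, toLin f m = toLin g m) :
    f = g := Subtype.ext (LinearMap.ext h)

@[simp] theorem toLin_id (M : GrMod k) (m : M) : toLin (𝟙 M) m = m := rfl

@[simp] theorem toLin_comp {M N P : GrMod k} (f : M ⟶ N) (g : N ⟶ P) (m : M) :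
    toLin (f ≫ g) m = toLin g (toLin f m) := rfl

instance (M N : GrMod k) : AddCommGroup (M ⟶ N) :=
  inferInstanceAs (AddCommGroup (homs M N))

@[simp] theorem toLin_add {M N : GrMod k} (f g : M ⟶ N) (m : M) :
    toLin (f + g) m = toLin f m + toLin g m := rfl

instance : Preadditive (GrMod k) where
  add_comp := by intros; ext; simp
  comp_add := by intros; rfl

@[simp] theorem toLin_zero {M N : GrMod k} (m : M) : toLin (0 : M ⟶ N) m = 0 := rfl

/-- The component of degree `i` of an element of a graded module. -/
def comp (M : GrMod k) (i : ℤ) : M →+ M := proj M.isInternal i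

theorem comp_toLin {M N : GrMod k} (f : M ⟶ N) (i : ℤ) (m : M) :
    N.comp i (toLin f m) = toLin f (M.comp i m) :=
  proj_map M.isInternal N.isInternal (toLin f).toAddMonoidHom (fun _ _ hm ↦ toLin_mem f hm) i m

/-- A submodule is homogeneous if it contains the components of all its elements. -/
def IsHomogeneous (M : GrMod k) (N : Submodule k[X] M) : Prop :=
  ∀ i, ∀ m ∈ N, M.comp i m ∈ N

/-- A homogeneous submodule, as a graded module. -/
def sub (M : GrMod k) (N : Submodule k[X] M) (hN : M.IsHomogeneous N) : GrMod k where
  carrier := N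
  grading i := (M.grading i).comap N.subtype.toAddMonoidHom
  isInternal := by
    refine isInternal_of_proj _ (fun i ↦ ((M.comp i).comp N.subtype.toAddMonoidHom).codRestrict
      N (fun m ↦ hN i _ m.2)) ?_ ?_ ?_ ?_
    · intro i m
      exact proj_mem M.isInternal i _
    · intro i m hm
      exact Subtype.ext (proj_same M.isInternal hm)
    · intro i j hij m hm
      exact Subtype.ext (proj_ne M.isInternal hij hm)
    · intro m
      obtain ⟨s, hs⟩ := exists_sum_proj M.isInternal m.1
      refine ⟨s, Subtype.ext ?_⟩
      rw [AddSubmonoidClass.coe_finsetSum]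
      exact hs
  smul_mem i j f hf m hm := M.smul_mem i j f hf m.1 hm

/-- The quotient by a homogeneous submodule, as a graded module. -/
def quot (M : GrMod k) (N : Submodule k[X] M) (hN : M.IsHomogeneous N) : GrMod k where
  carrier := M ⧸ N
  grading i := (M.grading i).map N.mkQ.toAddMonoidHom
  isInternal := by
    refine isInternal_of_proj _ (fun i ↦ QuotientAddGroup.map N.toAddSubgroup N.toAddSubgroup
      (M.comp i) (fun m hm ↦ hN i m hm)) ?_ ?_ ?_ ?_
    · intro i m
      obtain ⟨m, rfl⟩ := N.mkQ_surjective m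
      exact ⟨M.comp i m, proj_mem M.isInternal i _, rfl⟩
    · rintro i _ ⟨m, hm, rfl⟩
      exact congrArg N.mkQ (proj_same M.isInternal hm)
    · rintro i j hij _ ⟨m, hm, rfl⟩
      exact (congrArg N.mkQ (proj_ne M.isInternal hij hm)).trans (map_zero _)
    · intro m
      obtain ⟨m, rfl⟩ := N.mkQ_surjective m
      obtain ⟨s, hs⟩ := exists_sum_proj M.isInternal m
      refine ⟨s, ?_⟩
      conv_rhs => rw [← hs]
      rw [map_sum]
      rfl
  smul_mem := by
    rintro i j f hf _ ⟨m, hm, rfl⟩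
    exact ⟨f • m, M.smul_mem i j f hf m hm, rfl⟩

/-- The direct sum of two graded modules. -/
def prod (M N : GrMod k) : GrMod k where
  carrier := M × N
  grading i := (M.grading i).prod (N.grading i)
  isInternal := by
    classical
    refine isInternal_of_proj _ (fun i ↦ (M.comp i).prodMap (N.comp i)) ?_ ?_ ?_ ?_
    · intro i m
      exact ⟨proj_mem M.isInternal i _, proj_mem N.isInternal i _⟩
    · intro i m hm
      exact Prod.ext (proj_same M.isInternal hm.1) (proj_same N.isInternal hm.2)
    · intro i j hij m hm
      exact Prod.ext (proj_ne M.isInternal hij hm.1) (proj_ne N.isInternal hij hm.2)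
    · rintro ⟨m, n⟩
      have aux : ∀ (P : GrMod k) (p : P), ∃ s : Finset ℤ, ∀ t, s ⊆ t →
          ∑ i ∈ t, P.comp i p = p := by
        intro P p
        obtain ⟨s, hs⟩ := exists_sum_proj P.isInternal p
        refine ⟨s, fun t hst ↦ ?_⟩
        rw [← Finset.sum_subset hst]
        · exact hs
        · intro i _ hi
          change proj P.isInternal i p = 0
          rw [← hs, map_sum]
          refine Finset.sum_eq_zero fun j hj ↦ ?_
          exact proj_ne P.isInternal (fun hji ↦ hi (by rwa [← hji])) (proj_mem P.isInternal j p)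
      obtain ⟨s, hs⟩ := aux M m
      obtain ⟨t, ht⟩ := aux N n
      refine ⟨s ∪ t, Prod.ext ?_ ?_⟩
      · rw [Prod.fst_sum]
        exact hs _ Finset.subset_union_left
      · rw [Prod.snd_sum]
        exact ht _ Finset.subset_union_right
  smul_mem i j f hf m hm := ⟨M.smul_mem i j f hf m.1 hm.1, N.smul_mem i j f hf m.2 hm.2⟩

theorem isHomogeneous_ker {M N : GrMod k} (f : M ⟶ N) :
    M.IsHomogeneous (LinearMap.ker (toLin f)) := by
  intro i m hm
  rw [LinearMap.mem_ker] at hm ⊢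
  rw [← comp_toLin, hm, map_zero]

theorem isHomogeneous_range {M N : GrMod k} (f : M ⟶ N) :
    N.IsHomogeneous (LinearMap.range (toLin f)) := by
  rintro i _ ⟨m, rfl⟩
  exact ⟨M.comp i m, (comp_toLin f i m).symm⟩

/-- The inclusion of the kernel of a morphism. -/
def kerι {M N : GrMod k} (f : M ⟶ N) : M.sub _ (isHomogeneous_ker f) ⟶ M :=
  ofLin (LinearMap.ker (toLin f)).subtype (fun _ _ hm ↦ hm)

/-- The projection to the cokernel of a morphism. -/
def cokπ {M N : GrMod k} (f : M ⟶ N) : N ⟶ N.quot _ (isHomogeneous_range f) :=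
  ofLin (LinearMap.range (toLin f)).mkQ (fun _ m hm ↦ ⟨m, hm, rfl⟩)

theorem kerι_comp {M N : GrMod k} (f : M ⟶ N) : kerι f ≫ f = 0 := by
  ext m
  exact m.2

theorem comp_cokπ {M N : GrMod k} (f : M ⟶ N) : f ≫ cokπ f = 0 := by
  ext m
  exact (Submodule.Quotient.mk_eq_zero _).2 ⟨m, rfl⟩

/-- A morphism `f` is a kernel of `g` if it is injective with image the kernel of `g`. -/
def isLimitOfInjective {K M N : GrMod k} (f : K ⟶ M) (g : M ⟶ N) (w : f ≫ g = 0)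
    (hf : Function.Injective (toLin f))
    (hg : LinearMap.ker (toLin g) ≤ LinearMap.range (toLin f)) :
    IsLimit (KernelFork.ofι f w) :=
  let e := LinearEquiv.ofInjective (toLin f) hf
  have he : ∀ x, toLin f (e.symm x) = x := fun x ↦ congrArg Subtype.val (e.apply_symm_apply x)
  have hmem : ∀ {P : GrMod k} (h : P ⟶ M), h ≫ g = 0 →
      ∀ p, toLin h p ∈ LinearMap.range (toLin f) := fun h hh p ↦
    hg (by rw [LinearMap.mem_ker, ← toLin_comp, hh, toLin_zero])
  KernelFork.IsLimit.ofι f w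
    (fun h hh ↦ ofLin (e.symm.toLinearMap.comp ((toLin h).codRestrict _ (hmem h hh))) (by
      intro i p hp
      refine mem_of_proj K.isInternal fun j hj ↦ hf ?_
      have := comp_toLin f j (e.symm ((toLin h).codRestrict _ (hmem h hh) p))
      refine this.symm.trans ?_
      rw [he, map_zero]
      exact proj_ne M.isInternal (Ne.symm hj) (toLin_mem h hp)))
    (fun h hh ↦ by ext p; exact he _)
    (fun h hh m hm ↦ by
      ext p
      apply hf
      rw [← toLin_comp, hm]
      exact (he ((toLin h).codRestrict _ (hmem h hh) p)).symm)

/-- A morphism `g` is a cokernel of `f` if it is surjective with kernel the image of `f`. -/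
def isColimitOfSurjective {K M N : GrMod k} (f : K ⟶ M) (g : M ⟶ N) (w : f ≫ g = 0)
    (hg : Function.Surjective (toLin g))
    (hf : LinearMap.ker (toLin g) ≤ LinearMap.range (toLin f)) :
    IsColimit (CokernelCofork.ofπ g w) :=
  let e := (toLin g).quotKerEquivOfSurjective hg
  have hle : ∀ {P : GrMod k} (h : M ⟶ P), f ≫ h = 0 →
      LinearMap.ker (toLin g) ≤ LinearMap.ker (toLin h) := fun h hh m hm ↦ by
    obtain ⟨x, rfl⟩ := hf hm
    rw [LinearMap.mem_ker, ← toLin_comp, hh, toLin_zero]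
  have he : ∀ {P : GrMod k} (h : M ⟶ P) (hh : f ≫ h = 0) (m : M),
      (((LinearMap.ker (toLin g)).liftQ (toLin h) (hle h hh)).comp e.symm.toLinearMap)
        (toLin g m) = toLin h m := fun h hh m ↦ by
    have : e.symm (toLin g m) = Submodule.Quotient.mk m := by
      rw [LinearEquiv.symm_apply_eq]; rfl
    simp [this]
  CokernelCofork.IsColimit.ofπ g w
    (fun {P} h hh ↦ ofLin (((LinearMap.ker (toLin g)).liftQ (toLin h) (hle h hh)).comp
        e.symm.toLinearMap) (by
      intro i n hn
      obtain ⟨m, rfl⟩ := hg n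
      have h1 : toLin g m = toLin g (M.comp i m) := by
        rw [← comp_toLin]
        exact (proj_same N.isInternal hn).symm
      rw [h1, he h hh]
      exact toLin_mem h (proj_mem M.isInternal i m)))
    (fun h hh ↦ by ext m; exact he h hh m)
    (fun h hh m hm ↦ by
      ext n
      obtain ⟨n, rfl⟩ := hg n
      rw [← toLin_comp, hm]
      exact (he h hh n).symm)

instance : HasKernels (GrMod k) where
  has_limit f := ⟨⟨_, isLimitOfInjective (kerι f) f (kerι_comp f)
    Subtype.val_injective (fun m hm ↦ ⟨⟨m, hm⟩, rfl⟩)⟩⟩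

instance : HasCokernels (GrMod k) where
  has_colimit f := ⟨⟨_, isColimitOfSurjective f (cokπ f) (comp_cokπ f)
    (Submodule.mkQ_surjective _) (fun _ hm ↦ (Submodule.Quotient.mk_eq_zero _).1 hm)⟩⟩

instance (M N : GrMod k) : HasBinaryBiproduct M N :=
  hasBinaryBiproduct_of_total
    { pt := M.prod N
      fst := ofLin (LinearMap.fst k[X] M N) (fun _ _ hm ↦ hm.1)
      snd := ofLin (LinearMap.snd k[X] M N) (fun _ _ hm ↦ hm.2)
      inl := ofLin (LinearMap.inl k[X] M N) (fun i _ hm ↦ ⟨hm, zero_mem (N.grading i)⟩)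
      inr := ofLin (LinearMap.inr k[X] M N) (fun i _ hm ↦ ⟨zero_mem (M.grading i), hm⟩)
      inl_fst := rfl
      inl_snd := rfl
      inr_fst := rfl
      inr_snd := rfl }
    (by
      ext m
      exact Prod.ext (add_zero m.1) (zero_add m.2))

/-- The zero graded module. -/
def zero : GrMod k where
  carrier := PUnit.{u + 1}
  grading _ := ⊥
  isInternal := isInternal_of_proj _ (fun _ ↦ 0) (fun _ _ ↦ rfl) (fun _ _ _ ↦ rfl)
    (fun _ _ _ _ _ ↦ rfl) (fun _ ↦ ⟨∅, rfl⟩)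
  smul_mem _ _ _ _ _ _ := rfl

instance : HasZeroObject (GrMod k) :=
  ⟨zero, (IsZero.iff_id_eq_zero _).2 (by ext; rfl)⟩

instance : HasFiniteProducts (GrMod k) := by
  have : HasBinaryBiproducts (GrMod k) := ⟨fun M N ↦ inferInstance⟩
  exact hasFiniteProducts_of_has_binary_and_terminal

theorem injective_of_mono {M N : GrMod k} (f : M ⟶ N) [Mono f] :
    Function.Injective (toLin f) := by
  have h : kerι f = 0 := by
    rw [← cancel_mono f, kerι_comp, zero_comp]
  rw [← LinearMap.ker_eq_bot, eq_bot_iff]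
  intro m hm
  exact congrArg (fun g : M.sub _ (isHomogeneous_ker f) ⟶ M ↦ toLin g ⟨m, hm⟩) h

theorem surjective_of_epi {M N : GrMod k} (f : M ⟶ N) [Epi f] :
    Function.Surjective (toLin f) := by
  have h : cokπ f = 0 := by
    rw [← cancel_epi f, comp_cokπ, comp_zero]
  intro n
  exact (Submodule.Quotient.mk_eq_zero _).1
    (congrArg (fun g : N ⟶ N.quot _ (isHomogeneous_range f) ↦ toLin g n) h)

/-- The category `gr S` is abelian. -/
instance : Abelian (GrMod k) where
  normalMonoOfMono f _ := ⟨
    { Z := _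
      g := cokπ f
      w := comp_cokπ f
      isLimit := isLimitOfInjective f (cokπ f) (comp_cokπ f) (injective_of_mono f)
        (fun _ hm ↦ (Submodule.Quotient.mk_eq_zero _).1 hm) }⟩
  normalEpiOfEpi f _ := ⟨
    { W := _
      g := kerι f
      w := kerι_comp f
      isColimit := isColimitOfSurjective (kerι f) f (kerι_comp f) (surjective_of_epi f)
        (fun m hm ↦ ⟨⟨m, hm⟩, rfl⟩) }⟩

/-- The twist `M(j)`, with `M(j)_i = M_{i+j}`. -/
def twist (M : GrMod k) (j : ℤ) : GrMod k where
  carrier := M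
  grading i := M.grading (i + j)
  isInternal := by
    refine isInternal_of_proj _ (fun i ↦ M.comp (i + j)) ?_ ?_ ?_ ?_
    · exact fun i m ↦ proj_mem M.isInternal _ m
    · exact fun i m hm ↦ proj_same M.isInternal hm
    · exact fun i i' hi m hm ↦ proj_ne M.isInternal (fun h ↦ hi (add_right_cancel h)) hm
    · intro m
      obtain ⟨s, hs⟩ := exists_sum_proj M.isInternal m
      refine ⟨s.map (Equiv.subRight j).toEmbedding, ?_⟩
      rw [Finset.sum_map]
      refine Eq.trans (Finset.sum_congr rfl fun i _ ↦ ?_) hs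
      exact congrArg (fun l ↦ proj M.isInternal l m) (sub_add_cancel i j)
  smul_mem i i' f hf m hm := by
    rw [add_assoc]
    exact M.smul_mem i _ f hf m hm

variable (k) in
/-- The graded module `S`. -/
def free : GrMod k where
  carrier := k[X]
  grading := homogeneous k
  isInternal := isInternal_homogeneous k
  smul_mem _ _ _ hf _ hm := homogeneous_mul k hf hm

variable (k) in
theorem isHomogeneous_span_pow (n : ℕ) :
    (free k).IsHomogeneous (Ideal.span {(Polynomial.X : k[X]) ^ n}) := by
  have hX : (Polynomial.X : k[X]) ^ n ∈ homogeneous k n := by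
    intro m hm
    rw [Polynomial.coeff_X_pow] at hm
    by_contra h
    exact hm (if_neg fun h' ↦ h (by exact_mod_cast h'))
  let g : (free k).twist (-n) ⟶ free k :=
    ofLin (LinearMap.mulLeft k[X] ((Polynomial.X : k[X]) ^ n)) (by
      intro i m hm
      have h := homogeneous_mul k hX (show m ∈ homogeneous k (i + -n) from hm)
      rwa [show (n : ℤ) + (i + -n) = i by ring] at h)
  have h : Ideal.span {(Polynomial.X : k[X]) ^ n} = LinearMap.range (toLin g) := by
    ext x
    rw [Ideal.mem_span_singleton']
    constructor
    · rintro ⟨a, rfl⟩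
      exact ⟨a, mul_comm ((Polynomial.X : k[X]) ^ n) a⟩
    · rintro ⟨a, rfl⟩
      exact ⟨a, mul_comm (show k[X] from a) ((Polynomial.X : k[X]) ^ n)⟩
  rw [h]
  exact isHomogeneous_range g

variable (k) in
/-- The graded module `S/(y^n)`. -/
def truncated (n : ℕ) : GrMod k :=
  (free k).quot (Ideal.span {(Polynomial.X : k[X]) ^ n}) (isHomogeneous_span_pow k n)

end GrMod

/-! ### Arcs and saturated sets of arcs -/

/-- An arc: a pair `(a, b)` with `a < b` in `ℤ ⊔ {-∞}`, where `-∞` is `⊥`. -/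
@[ext]
structure Arc where
  src : WithBot ℤ
  tgt : WithBot ℤ
  lt : src < tgt

namespace Arc

/-- The target of an arc, which is always an integer. -/
def tgtInt (α : Arc) : ℤ := α.tgt.unbot (ne_bot_of_gt α.lt)

/-- The graded module of an arc: `M_(-∞,b) = S(b)` and `M_(a,b) = S/(y^(b-a))(b)` for
`a ∈ ℤ`. -/
def grMod (α : Arc) : GrMod k :=
  match α.src with
  | ⊥ => (GrMod.free k).twist α.tgtInt
  | (a : ℤ) => (GrMod.truncated k (α.tgtInt - a).toNat).twist α.tgtInt

/-- A set of arcs is saturated if, whenever it contains `(a, b)` and `(c, d)` with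
`a ≤ c ≤ b ≤ d`, it contains those of `(a, c)`, `(c, b)`, `(b, d)`, `(a, d)` that are arcs. -/
def IsSaturated (U : Set Arc) : Prop :=
  ∀ ⦃a b c d : WithBot ℤ⦄ (hab : a < b) (hcd : c < d),
    (⟨a, b, hab⟩ : Arc) ∈ U → (⟨c, d, hcd⟩ : Arc) ∈ U → a ≤ c → c ≤ b → b ≤ d →
      (∀ h : a < c, (⟨a, c, h⟩ : Arc) ∈ U) ∧ (∀ h : c < b, (⟨c, b, h⟩ : Arc) ∈ U) ∧
      (∀ h : b < d, (⟨b, d, h⟩ : Arc) ∈ U) ∧ (∀ h : a < d, (⟨a, d, h⟩ : Arc) ∈ U)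

theorem IsSaturated.sInter {F : Set (Set Arc)} (hF : ∀ U ∈ F, IsSaturated U) :
    IsSaturated (⋂₀ F) := fun _ _ _ _ hab hcd h₁ h₂ h₃ h₄ h₅ ↦
  ⟨fun h U hU ↦ (hF U hU hab hcd (h₁ U hU) (h₂ U hU) h₃ h₄ h₅).1 h,
    fun h U hU ↦ (hF U hU hab hcd (h₁ U hU) (h₂ U hU) h₃ h₄ h₅).2.1 h,
    fun h U hU ↦ (hF U hU hab hcd (h₁ U hU) (h₂ U hU) h₃ h₄ h₅).2.2.1 h,
    fun h U hU ↦ (hF U hU hab hcd (h₁ U hU) (h₂ U hU) h₃ h₄ h₅).2.2.2 h⟩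

end Arc

/-- `Sat(𝒜)`: the saturated sets of arcs. -/
@[ext]
structure Sat where
  arcs : Set Arc
  isSaturated : Arc.IsSaturated arcs

namespace Sat

instance : PartialOrder Sat := PartialOrder.lift Sat.arcs fun _ _ ↦ Sat.ext

instance : InfSet Sat :=
  ⟨fun F ↦ ⟨⋂₀ (Sat.arcs '' F), Arc.IsSaturated.sInter (by
    rintro _ ⟨U, _, rfl⟩
    exact U.isSaturated)⟩⟩

/-- Saturated sets of arcs, ordered by inclusion, form a complete lattice; meets are
intersections. -/
instance : CompleteLattice Sat :=
  completeLatticeOfInf Sat fun F ↦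
    ⟨fun U hU ↦ show (⋂₀ (Sat.arcs '' F)) ⊆ U.arcs from Set.sInter_subset_of_mem ⟨U, hU, rfl⟩,
      fun U hU ↦ show U.arcs ⊆ ⋂₀ (Sat.arcs '' F) from by
        refine Set.subset_sInter ?_
        rintro _ ⟨V, hV, rfl⟩
        exact hU hV⟩

/-- The saturated set `𝒜_f` of all arcs of finite length. -/
def finiteArcs : Sat where
  arcs := {α | α.src ≠ ⊥}
  isSaturated _ _ _ _ _ hcd h₁ h₂ _ h₄ _ :=
    ⟨fun _ ↦ h₁, fun _ ↦ h₂, fun _ h ↦ h₂ (by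
      exact le_bot_iff.1 (h₄.trans (le_of_eq h))), fun _ ↦ h₁⟩

end Sat

/-- `Sat(𝒜_f)`: the saturated sets of arcs of finite length, a complete lattice under
inclusion. -/
abbrev SatFinite : Type := Set.Iic Sat.finiteArcs

/-! ### Thick subcategories -/

section Thick

variable (T : Type u) [Category.{v} T] [HasZeroObject T] [HasShift T ℤ] [Preadditive T]
  [∀ n : ℤ, (shiftFunctor T n).Additive] [Pretriangulated T]

/-- A thick subcategory of a triangulated category: a triangulated subcategory (full, nonempty,
closed under shifts and cones) that is closed under direct summands, hence under isomorphisms. -/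
@[ext]
structure Thick where
  prop : ObjectProperty T
  isTriangulated : prop.IsTriangulated
  isStableUnderRetracts : prop.IsStableUnderRetracts

namespace Thick

variable {T}

instance : PartialOrder (Thick T) := PartialOrder.lift Thick.prop fun _ _ ↦ Thick.ext

instance : InfSet (Thick T) :=
  ⟨fun F ↦
    have hr : ObjectProperty.IsStableUnderRetracts (C := T) (fun X ↦ ∀ P ∈ F, P.prop X) :=
      ⟨fun r hY P hP ↦
        have := P.isStableUnderRetracts
        P.prop.prop_of_retract r (hY P hP)⟩
    { prop := fun X ↦ ∀ P ∈ F, P.prop X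
      isTriangulated :=
        { exists_zero := ⟨(HasZeroObject.zero' T).zero, isZero_zero T, fun P _ ↦
            have := P.isTriangulated
            have := P.isStableUnderRetracts
            P.prop.prop_zero⟩
          isStableUnderShiftBy := fun n ↦ ⟨fun X hX P hP ↦
            have := P.isTriangulated
            P.prop.le_shift n X (hX P hP)⟩
          ext₂' := fun D hD h₁ h₃ ↦ ObjectProperty.le_isoClosure _ _ fun P hP ↦
            have := P.isTriangulated
            have := P.isStableUnderRetracts
            P.prop.ext_of_isTriangulatedClosed₂ D hD (h₁ P hP) (h₃ P hP) }
      isStableUnderRetracts := hr }⟩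

/-- Thick subcategories, ordered by inclusion, form a complete lattice; meets are
intersections. -/
instance : CompleteLattice (Thick T) :=
  completeLatticeOfInf (Thick T) fun _ ↦
    ⟨fun P hP _ hX ↦ hX P hP, fun _ hP X hX _ hQ ↦ hP hQ X hX⟩

end Thick

variable {T}

/-- `add P`: the direct summands of finite direct sums of objects satisfying `P`. -/
def add (P : ObjectProperty T) : ObjectProperty T := fun X ↦
  ∃ (n : ℕ) (Y : Fin n → T), (∀ i, P (Y i)) ∧ Nonempty (Retract X (⨁ Y))

end Thick

/-! ### The bounded derived category of `gr S` and the torsion subcategory -/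

instance : HasDerivedCategory.{u + 1} (GrMod k) := HasDerivedCategory.standard (GrMod k)

/-- The bounded derived category `D^b(gr S)`. -/
abbrev Db : Type (u + 1) := DerivedCategory.Bounded (GrMod k)

variable {k} in
/-- A graded module as a stalk complex in degree `0`. -/
def stalk (M : GrMod k) : Db k :=
  ⟨(DerivedCategory.singleFunctor (GrMod k) 0).obj M, ⟨0, inferInstance⟩, ⟨0, inferInstance⟩⟩

/-- The complexes whose cohomology has finite length. As the complexes are bounded, this is
the same for the individual cohomology modules and for their direct sum. -/
def torsion : ObjectProperty (Db k) := fun X ↦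
  ∀ n : ℤ, IsFiniteLength k[X] ((DerivedCategory.homologyFunctor (GrMod k) n).obj X.obj)

theorem isFiniteLength_of_exact (A : ShortComplex (GrMod k)) (hA : A.Exact)
    (h₁ : IsFiniteLength k[X] A.X₁) (h₃ : IsFiniteLength k[X] A.X₃) :
    IsFiniteLength k[X] A.X₂ := by
  have hex : LinearMap.ker (GrMod.toLin A.g) ≤ LinearMap.range (GrMod.toLin A.f) := by
    intro m hm
    have := A.exact_iff_epi_kernel_lift.1 hA
    let z : A.X₂.sub _ (GrMod.isHomogeneous_ker A.g) := ⟨m, hm⟩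
    obtain ⟨x, hx⟩ := GrMod.surjective_of_epi (kernel.lift A.g A.f A.zero)
      (GrMod.toLin (kernel.lift A.g (GrMod.kerι A.g) (GrMod.kerι_comp A.g)) z)
    refine ⟨x, ?_⟩
    have h := congrArg (GrMod.toLin (kernel.ι A.g)) hx
    rw [← GrMod.toLin_comp, ← GrMod.toLin_comp, kernel.lift_ι, kernel.lift_ι] at h
    exact h
  rw [isFiniteLength_iff_isNoetherian_isArtinian] at h₁ h₃ ⊢
  obtain ⟨_, _⟩ := h₁
  obtain ⟨_, _⟩ := h₃
  have hr : Function.Exact (GrMod.toLin A.f) (GrMod.toLin A.g) := by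
    intro m
    refine ⟨fun hm ↦ hex hm, ?_⟩
    rintro ⟨x, rfl⟩
    rw [← GrMod.toLin_comp, A.zero, GrMod.toLin_zero]
  exact ⟨isNoetherian_of_range_eq_ker _ _ hr.linearMap_ker_eq.symm,
    isArtinian_of_range_eq_ker _ _ hr.linearMap_ker_eq.symm⟩

theorem isFiniteLength_of_iso {M N : GrMod k} (e : M ≅ N) (h : IsFiniteLength k[X] M) :
    IsFiniteLength k[X] N :=
  h.of_surjective (GrMod.surjective_of_epi e.hom)

/-- The torsion complexes form a triangulated subcategory of `D^b(gr S)`. -/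
instance : (torsion k).IsTriangulated where
  exists_zero := by
    obtain ⟨Z, hZ⟩ := HasZeroObject.zero (C := Db k)
    refine ⟨Z, hZ, fun n ↦ ?_⟩
    have h : IsZero ((DerivedCategory.homologyFunctor (GrMod k) n).obj Z.obj) :=
      Functor.map_isZero _ (Functor.map_isZero DerivedCategory.Bounded.ι hZ)
    have : Subsingleton ((DerivedCategory.homologyFunctor (GrMod k) n).obj Z.obj) :=
      ⟨fun x y ↦ by
        have hid := (IsZero.iff_id_eq_zero _).1 h
        rw [← GrMod.toLin_id _ x, ← GrMod.toLin_id _ y, hid, GrMod.toLin_zero, GrMod.toLin_zero]⟩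
    exact .of_subsingleton
  isStableUnderShiftBy n := ⟨fun X hX m ↦ by
    have e₁ : (DerivedCategory.homologyFunctor (GrMod k) (n + m)).obj X.obj ≅
        (DerivedCategory.homologyFunctor (GrMod k) m).obj (X.obj⟦n⟧) :=
      (((DerivedCategory.homologyFunctor (GrMod k) 0).shiftIso n m (n + m) rfl).app X.obj).symm
    have e₂ := (DerivedCategory.homologyFunctor (GrMod k) m).mapIso
      ((DerivedCategory.Bounded.ι.commShiftIso n).app X)
    exact isFiniteLength_of_iso k (e₁ ≪≫ e₂.symm) (hX (n + m))⟩
  ext₂' D hD h₁ h₃ := ObjectProperty.le_isoClosure _ _ fun n ↦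
    isFiniteLength_of_exact k _
      ((DerivedCategory.homologyFunctor (GrMod k) n).map_distinguished_exact _
        (DerivedCategory.Bounded.ι.map_distinguished D hD)) (h₁ n) (h₃ n)

/-- `D^b_tors(gr S)`: the full triangulated subcategory of `D^b(gr S)` of the complexes whose
cohomology has finite length. -/
abbrev DbTors : Type (u + 1) := (torsion k).FullSubcategory

/-! ### The two assignments -/

/-- `τ(U) = add {Σ^l M_(a,b) | l ∈ ℤ, (a,b) ∈ U}`. -/
def tau (U : Set Arc) : ObjectProperty (Db k) :=
  add fun X ↦ ∃ (l : ℤ) (α : Arc), α ∈ U ∧ X = (stalk (α.grMod k))⟦l⟧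

/-- `σ(P)`: the arcs whose modules, as stalk complexes, lie in `P`. -/
def sigma (P : ObjectProperty (Db k)) : Set Arc := {α | P (stalk (α.grMod k))}

end ArcModel
end

noncomputable section

namespace ArcModel

/-! ### Graded modules, degree by degree -/

namespace GrMod

variable {k : Type u} [Field k] {M N : GrMod k}

/-! Saturation of a set of arcs says that "equal or joined by an arc" is an equivalence relation on
`ℤ ⊔ {-∞}` whose classes do not cross. Three facts then give the theorem.

Decomposition. In a nonzero finitely generated graded module, an element of lowest degree generates
an arc module that splits off (`GrMod.exists_retract`), and noetherianity makes the splitting stop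
(`GrMod.induction_arc`). Arc modules have projective resolutions of length at most one, so `Ext^2`
and higher vanish (`singleFunctor_hom_eq_zero`) and truncation triangles split. Every object of
`D^b(gr S)` is thus a finite sum of shifted arc modules (`decomposes`), and a thick subcategory is
recovered from its arcs (`tau_sigma`).

Closure. Two families of short exact sequences, one for concatenated and one for crossing arcs, show
that the arcs of a thick subcategory form a saturated set (`isSaturated_sigma`).

Separation. No cone in `τ(U)` is ever computed; instead `τ(U)` is exhibited as an intersection of
thick subcategories. For integers `v ≤ u`, the complexes on whose cohomology `y^(u-v)` is bijective
from degree `-u` to degree `-v` form a thick subcategory, by the five lemma, and it contains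
`M_(a,b)` iff `[v,u)` contains both or neither of `a`, `b`. If `U` is saturated and `(p,q)` is not
in `U`, noncrossing yields an interval of integers that contains exactly one of `p`, `q` and never
separates the ends of an arc of `U` (`Arc.IsSaturated.exists_ordConnected`). The interval may be
infinite, so `test` exhausts it by finite ones and asks for bijectivity almost always. The
intersection of all tests passed by `U` therefore has exactly the arcs `U` (`sigma_thickOfSat`), and
by decomposition it equals `τ(U)` (`thickOfSat_prop`).

For torsion complexes, `M_(a,b)` has finite length iff `a ≠ -∞` (`sigma_torsion`), and the
isomorphism restricts. -/

theorem comp_mem (M : GrMod k) (i : ℤ) (m : M) : M.comp i m ∈ M.grading i :=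
  proj_mem M.isInternal i m

theorem comp_same {i : ℤ} {m : M} (hm : m ∈ M.grading i) : M.comp i m = m :=
  proj_same M.isInternal hm

theorem comp_ne {i j : ℤ} (hij : i ≠ j) {m : M} (hm : m ∈ M.grading i) : M.comp j m = 0 :=
  proj_ne M.isInternal hij hm

theorem exists_sum_comp (m : M) : ∃ s : Finset ℤ, ∑ i ∈ s, M.comp i m = m :=
  exists_sum_proj M.isInternal m

theorem induction_homogeneous {p : M → Prop} (h0 : p 0) (hadd : ∀ x y, p x → p y → p (x + y))
    (h : ∀ i, ∀ m ∈ M.grading i, p m) (m : M) : p m := by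
  obtain ⟨s, hs⟩ := exists_sum_comp m
  rw [← hs]
  exact Finset.sum_induction _ p hadd h0 fun i _ ↦ h i _ (M.comp_mem i m)

theorem eq_zero_of_comp {m : M} (h : ∀ i, M.comp i m = 0) : m = 0 := by
  obtain ⟨s, hs⟩ := exists_sum_comp m
  rw [← hs]
  exact Finset.sum_eq_zero fun i _ ↦ h i

theorem exists_comp_eq_zero (m : M) : ∃ s : Finset ℤ, ∀ i ∉ s, M.comp i m = 0 := by
  obtain ⟨s, hs⟩ := exists_sum_comp m
  refine ⟨s, fun i hi ↦ ?_⟩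
  rw [← hs, map_sum]
  exact Finset.sum_eq_zero fun j hj ↦
    comp_ne (fun h : j = i ↦ hi (h ▸ hj)) (M.comp_mem j m)

theorem C_mem_homogeneous (c : k) : Polynomial.C c ∈ homogeneous k 0 := by
  intro n hn
  by_contra h
  exact hn (Polynomial.coeff_C_of_ne_zero (by exact_mod_cast h))

variable (k) in
theorem X_pow_mem_homogeneous (n : ℕ) : (Polynomial.X : k[X]) ^ n ∈ homogeneous k n := by
  intro m hm
  rw [Polynomial.coeff_X_pow] at hm
  by_contra h
  exact hm (if_neg fun h' ↦ h (by exact_mod_cast h'))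

theorem C_smul_mem {i : ℤ} {m : M} (hm : m ∈ M.grading i) (c : k) :
    Polynomial.C c • m ∈ M.grading i := by
  simpa using M.smul_mem 0 i _ (C_mem_homogeneous c) m hm

theorem X_pow_smul_mem {i : ℤ} {m : M} (hm : m ∈ M.grading i) (n : ℕ) :
    (Polynomial.X : k[X]) ^ n • m ∈ M.grading (i + n) := by
  simpa [add_comm] using M.smul_mem n i _ (X_pow_mem_homogeneous k n) m hm

theorem X_smul_mem {i : ℤ} {m : M} (hm : m ∈ M.grading i) :
    (Polynomial.X : k[X]) • m ∈ M.grading (i + 1) := by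
  simpa using X_pow_smul_mem hm 1

theorem comp_C_smul (i : ℤ) (c : k) (m : M) :
    M.comp i (Polynomial.C c • m) = Polynomial.C c • M.comp i m := by
  induction m using induction_homogeneous with
  | h0 => simp
  | hadd x y hx hy => simp only [smul_add, map_add, hx, hy]
  | h j m hm =>
    by_cases hij : j = i
    · subst hij
      rw [comp_same hm, comp_same (C_smul_mem hm c)]
    · rw [comp_ne hij hm, comp_ne hij (C_smul_mem hm c), smul_zero]

theorem comp_X_smul (i : ℤ) (m : M) :
    M.comp (i + 1) ((Polynomial.X : k[X]) • m) = (Polynomial.X : k[X]) • M.comp i m := by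
  induction m using induction_homogeneous with
  | h0 => simp
  | hadd x y hx hy => simp only [smul_add, map_add, hx, hy]
  | h j m hm =>
    by_cases hij : j = i
    · subst hij
      rw [comp_same hm, comp_same (X_smul_mem hm)]
    · rw [comp_ne hij hm, comp_ne (fun h ↦ hij (add_right_cancel h)) (X_smul_mem hm), smul_zero]

/-- An additive subgroup stable under scalars and `X` is stable under polynomials. -/
theorem smul_mem_of_C_of_X {A : Type*} [AddCommGroup A] [Module k[X] A] (B : AddSubgroup A)
    (hC : ∀ (c : k), ∀ m ∈ B, Polynomial.C c • m ∈ B)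
    (hX : ∀ m ∈ B, (Polynomial.X : k[X]) • m ∈ B) (f : k[X]) {m : A} (hm : m ∈ B) :
    f • m ∈ B := by
  induction f using Polynomial.induction_on' with
  | add p q hp hq => rw [add_smul]; exact add_mem hp hq
  | monomial n c =>
    rw [← Polynomial.C_mul_X_pow_eq_monomial, mul_smul]
    refine hC c _ ?_
    induction n with
    | zero => simpa using hm
    | succ n ih => rw [pow_succ', mul_smul]; exact hX _ ih

/-- A morphism of graded modules from an additive map compatible with scalars, with `X` and with
the gradings. -/
theorem exists_hom_of_addMonoidHom (ρ : M →+ N) (hdeg : ∀ i, ∀ m ∈ M.grading i, ρ m ∈ N.grading i)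
    (hC : ∀ (c : k) i, ∀ m ∈ M.grading i, ρ (Polynomial.C c • m) = Polynomial.C c • ρ m)
    (hX : ∀ i, ∀ m ∈ M.grading i,
      ρ ((Polynomial.X : k[X]) • m) = (Polynomial.X : k[X]) • ρ m) :
    ∃ g : M ⟶ N, ∀ m, toLin g m = ρ m := by
  have hC' : ∀ (c : k) (m : M), ρ (Polynomial.C c • m) = Polynomial.C c • ρ m := fun c m ↦ by
    induction m using induction_homogeneous with
    | h0 => simp
    | hadd x y hx hy => simp only [smul_add, map_add, hx, hy]
    | h i m hm => exact hC c i m hm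
  have hX' : ∀ (m : M), ρ ((Polynomial.X : k[X]) • m) = (Polynomial.X : k[X]) • ρ m := fun m ↦ by
    induction m using induction_homogeneous with
    | h0 => simp
    | hadd x y hx hy => simp only [smul_add, map_add, hx, hy]
    | h i m hm => exact hX i m hm
  let L : M →ₗ[k[X]] N :=
    { ρ with
      map_smul' := fun f m ↦ by
        change ρ (f • m) = f • ρ m
        induction f using Polynomial.induction_on' with
        | add p q hp hq => rw [add_smul, map_add, hp, hq, add_smul]
        | monomial n c =>
          rw [← Polynomial.C_mul_X_pow_eq_monomial, mul_smul, hC', mul_smul]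
          congr 1
          induction n with
          | zero => simp
          | succ n ih => rw [pow_succ', mul_smul, hX', ih, mul_smul] }
  exact ⟨ofLin L hdeg, fun m ↦ rfl⟩

/-- An additive map out of a graded module from a family of additive maps on the components. -/
theorem exists_addMonoidHom_of_components {A : Type*} [AddCommGroup A]
    (ρ : ℤ → M →+ A) :
    ∃ r : M →+ A, ∀ i, ∀ m ∈ M.grading i, r m = ρ i m := by
  classical
  let := M.isInternal.chooseDecomposition
  refine ⟨(DirectSum.toAddMonoid fun i ↦ (ρ i).comp (M.grading i).subtype).comp
    (DirectSum.decomposeAddEquiv M.grading).toAddMonoidHom, fun i m hm ↦ ?_⟩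
  have : DirectSum.decompose M.grading m = DirectSum.of (fun i ↦ M.grading i) i ⟨m, hm⟩ :=
    DirectSum.decompose_of_mem _ hm
  simp [this]

/-- Finitely many generators have finitely many components in all, and the elements without
components below a fixed degree form a submodule, since `X` raises degrees. -/
theorem exists_grading_eq_bot_of_lt (M : GrMod k) : ∃ n : ℤ, ∀ i < n, ∀ m ∈ M.grading i, m = 0 := by
  obtain ⟨T, hT⟩ := (Module.Finite.fg_top : (⊤ : Submodule k[X] M).FG)
  choose s hs using fun m : M ↦ exists_comp_eq_zero m
  obtain ⟨n, hn⟩ : ∃ n : ℤ, ∀ t ∈ T, ∀ i < n, M.comp i t = 0 := by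
    classical
    obtain ⟨n, hn⟩ := (T.biUnion s).bddBelow
    refine ⟨n, fun t ht i hi ↦ hs t i fun hi' ↦ ?_⟩
    exact absurd (hn (Finset.mem_coe.2 (Finset.mem_biUnion.2 ⟨t, ht, hi'⟩))) (not_le.2 hi)
  let B : AddSubgroup M :=
    { carrier := {m | ∀ i < n, M.comp i m = 0}
      zero_mem' := fun i _ ↦ map_zero _
      add_mem' := fun hx hy i hi ↦ by rw [map_add, hx i hi, hy i hi, add_zero]
      neg_mem' := fun hx i hi ↦ by rw [map_neg, hx i hi, neg_zero] }
  let B' : Submodule k[X] M :=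
    { B with
      smul_mem' := fun f m hm ↦ smul_mem_of_C_of_X B
        (fun c m hm i hi ↦ by rw [comp_C_smul, hm i hi, smul_zero])
        (fun m hm i hi ↦ by
          rw [← sub_add_cancel i 1, comp_X_smul, hm (i - 1) (by lia), smul_zero]) f hm }
  have hB : (⊤ : Submodule k[X] M) ≤ B' := by
    rw [← hT, Submodule.span_le]
    exact fun t ht ↦ hn t ht
  refine ⟨n, fun i hi m hm ↦ ?_⟩
  rw [← comp_same hm]
  exact hB (Submodule.mem_top : m ∈ ⊤) i hi

/-- The nonzero component of lowest degree. -/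
theorem exists_lowest (M : GrMod k) (h : ∃ m : M, m ≠ 0) :
    ∃ (s : ℤ) (x : M), x ≠ 0 ∧ x ∈ M.grading s ∧ ∀ i < s, ∀ m ∈ M.grading i, m = 0 := by
  obtain ⟨n, hn⟩ := M.exists_grading_eq_bot_of_lt
  have : ∃ s : ℤ, ∃ x : M, x ≠ 0 ∧ x ∈ M.grading s := by
    by_contra! hcon
    obtain ⟨m, hm⟩ := h
    exact hm (eq_zero_of_comp fun i ↦ by_contra fun hi ↦ hcon i _ hi (M.comp_mem i m))
  obtain ⟨s, ⟨x, hx, hxs⟩, hs⟩ := Int.exists_least_of_bdd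
    (P := fun s ↦ ∃ x : M, x ≠ 0 ∧ x ∈ M.grading s)
    ⟨n, fun z ⟨x, hx, hxz⟩ ↦ by
      by_contra! hz
      exact hx (hn z hz x hxz)⟩ this
  refine ⟨s, x, hx, hxs, fun i hi m hm ↦ ?_⟩
  by_contra hm0
  exact absurd (hs i ⟨m, hm0, hm⟩) (not_le.2 hi)

theorem exact_of_ker_le_range {S : ShortComplex (GrMod k)}
    (hf : Function.Injective (toLin S.f))
    (h : LinearMap.ker (toLin S.g) ≤ LinearMap.range (toLin S.f)) : S.Exact :=
  S.exact_of_f_is_kernel (isLimitOfInjective S.f S.g S.zero hf h)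

theorem mono_of_injective (f : M ⟶ N) (hf : Function.Injective (toLin f)) : Mono f :=
  ⟨fun g h hgh ↦ by
    ext m
    exact hf (by rw [← toLin_comp, hgh, toLin_comp])⟩

theorem epi_of_surjective (f : M ⟶ N) (hf : Function.Surjective (toLin f)) : Epi f :=
  ⟨fun g h hgh ↦ by
    ext m
    obtain ⟨m, rfl⟩ := hf m
    rw [← toLin_comp, hgh, toLin_comp]⟩

theorem shortExact_of_toLin {S : ShortComplex (GrMod k)}
    (hf : Function.Injective (toLin S.f)) (hg : Function.Surjective (toLin S.g))
    (h : ∀ m, toLin S.g m = 0 → ∃ n, toLin S.f n = m) : S.ShortExact where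
  exact := exact_of_ker_le_range hf fun m hm ↦ h m hm
  mono_f := mono_of_injective _ hf
  epi_g := epi_of_surjective _ hg

/-- Exactness in `gr S` is exactness of the underlying linear maps. -/
theorem exists_of_exact {S : ShortComplex (GrMod k)} (hS : S.Exact) {m : S.X₂}
    (hm : toLin S.g m = 0) : ∃ x, toLin S.f x = m := by
  have := S.exact_iff_epi_kernel_lift.1 hS
  let z : S.X₂.sub _ (isHomogeneous_ker S.g) := ⟨m, hm⟩
  obtain ⟨x, hx⟩ := surjective_of_epi (kernel.lift S.g S.f S.zero)
    (toLin (kernel.lift S.g (kerι S.g) (kerι_comp S.g)) z)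
  refine ⟨x, ?_⟩
  have h := congrArg (toLin (kernel.ι S.g)) hx
  rw [← toLin_comp, ← toLin_comp, kernel.lift_ι, kernel.lift_ι] at h
  exact h

theorem exists_homogeneous_of_exact {S : ShortComplex (GrMod k)} (hS : S.Exact) {i : ℤ} {m : S.X₂}
    (hi : m ∈ S.X₂.grading i) (hm : toLin S.g m = 0) :
    ∃ x ∈ S.X₁.grading i, toLin S.f x = m := by
  obtain ⟨x, rfl⟩ := exists_of_exact hS hm
  exact ⟨S.X₁.comp i x, comp_mem _ i x, by rw [← comp_toLin, comp_same hi]⟩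

theorem isZero_iff_forall_eq_zero : IsZero M ↔ ∀ m : M, m = 0 := by
  rw [IsZero.iff_id_eq_zero]
  exact ⟨fun h m ↦ by rw [← toLin_id M m, h, toLin_zero], fun h ↦ by ext m; exact h _⟩

end GrMod
end ArcModel

namespace ArcModel

/-! ### Maps out of cyclic graded modules -/

namespace GrMod

variable {k : Type u} [Field k] {M N : GrMod k}

theorem monomial_smul_mem {s : ℤ} {x : M} (hx : x ∈ M.grading s) (n : ℕ) (c : k) :
    Polynomial.monomial n c • x ∈ M.grading (s + n) := by
  rw [← Polynomial.C_mul_X_pow_eq_monomial, mul_smul]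
  exact C_smul_mem (X_pow_smul_mem hx n) c

theorem comp_smul_of_mem {s : ℤ} {x : M} (hx : x ∈ M.grading s) (f : k[X]) (j : ℕ) :
    M.comp (s + j) (f • x) = Polynomial.monomial j (f.coeff j) • x := by
  induction f using Polynomial.induction_on' with
  | add p q hp hq => simp only [add_smul, map_add, hp, hq, Polynomial.coeff_add]
  | monomial n c =>
    by_cases h : n = j
    · subst h
      rw [comp_same (monomial_smul_mem hx n c), Polynomial.coeff_monomial_same]
    · rw [comp_ne (fun h' ↦ h (by lia)) (monomial_smul_mem hx n c),
        Polynomial.coeff_monomial_of_ne _ (Ne.symm h), map_zero, zero_smul]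

theorem comp_smul_of_lt {s : ℤ} {x : M} (hx : x ∈ M.grading s) (f : k[X]) {i : ℤ} (hi : i < s) :
    M.comp i (f • x) = 0 := by
  induction f using Polynomial.induction_on' with
  | add p q hp hq => simp only [add_smul, map_add, hp, hq, add_zero]
  | monomial n c => exact comp_ne (by lia) (monomial_smul_mem hx n c)

/-- A graded module generated by a homogeneous element `g` maps to every graded module which has
an element of the same degree killed by the annihilator of `g`. -/
theorem exists_hom_of_generator {s : ℤ} {g : M} (hg : g ∈ M.grading s)
    (hspan : ∀ m : M, ∃ f : k[X], f • g = m) {n : N} (hn : n ∈ N.grading s)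
    (hann : ∀ f : k[X], f • g = 0 → f • n = 0) :
    ∃ φ : M ⟶ N, toLin φ g = n := by
  let π : k[X] →ₗ[k[X]] M := LinearMap.toSpanSingleton k[X] M g
  have hπ : Function.Surjective π := hspan
  have hle : LinearMap.ker π ≤ LinearMap.ker (LinearMap.toSpanSingleton k[X] N n) :=
    fun f hf ↦ hann f hf
  let L : M →ₗ[k[X]] N := ((LinearMap.ker π).liftQ _ hle).comp
    (π.quotKerEquivOfSurjective hπ).symm.toLinearMap
  have hL : ∀ f : k[X], L (f • g) = f • n := fun f ↦ by
    have : (π.quotKerEquivOfSurjective hπ).symm (f • g) = Submodule.Quotient.mk f := by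
      rw [LinearEquiv.symm_apply_eq]; rfl
    change ((LinearMap.ker π).liftQ _ hle) ((π.quotKerEquivOfSurjective hπ).symm (f • g)) = _
    rw [this]
    rfl
  refine ⟨ofLin L fun i m hm ↦ ?_, ?_⟩
  · obtain ⟨f, rfl⟩ := hspan m
    -- A homogeneous `f • g` equals its own component, so `f` may be replaced by a single monomial.
    rw [← comp_same hm]
    rcases lt_or_ge i s with hi | hi
    · rw [comp_smul_of_lt hg f hi, map_zero]
      exact zero_mem _
    · obtain ⟨j, rfl⟩ := Int.le.dest hi
      rw [comp_smul_of_mem hg, hL]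
      exact monomial_smul_mem hn _ _
  · simpa using hL 1

end GrMod

/-! ### Arc modules: generator, annihilator and graded pieces -/

namespace Arc

variable {k : Type u} [Field k]

variable (k) in
/-- The annihilator of the generator of the module of an arc. -/
def ann (α : Arc) : k[X] :=
  match α.src with
  | ⊥ => 0
  | (a : ℤ) => Polynomial.X ^ (α.tgtInt - a).toNat

theorem coe_tgtInt (α : Arc) : (α.tgtInt : WithBot ℤ) = α.tgt := WithBot.coe_unbot _ _

/-- The class of `1`, which the twist by `b` puts in degree `-b`. An annihilator equal to `0`
encodes the free case, so later arguments can treat both kinds of arcs at once. -/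
theorem exists_generator (α : Arc) :
    ∃ g : α.grMod k, g ∈ (α.grMod k).grading (-α.tgtInt) ∧ (∀ m, ∃ f : k[X], f • g = m) ∧
      ∀ f : k[X], f • g = 0 ↔ α.ann k ∣ f := by
  have h1 : (1 : k[X]) ∈ homogeneous k (-α.tgtInt + α.tgtInt) := by
    have := GrMod.X_pow_mem_homogeneous k 0
    simpa using this
  obtain ⟨src, tgt, lt⟩ := α
  induction src using WithBot.recBotCoe with
  | bot =>
    exact ⟨(1 : k[X]), h1, fun m ↦ ⟨m, mul_one (show k[X] from m)⟩,
      fun f ↦ (Eq.congr (mul_one (f : k[X])) rfl).trans zero_dvd_iff.symm⟩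
  | coe a =>
    refine ⟨Submodule.Quotient.mk (p := Ideal.span {(Polynomial.X : k[X]) ^ _}) (1 : k[X]),
      ⟨(1 : k[X]), h1, rfl⟩, fun m ↦ ?_, fun f ↦ ?_⟩
    · obtain ⟨f, rfl⟩ := Submodule.mkQ_surjective (Ideal.span {(Polynomial.X : k[X]) ^ _}) m
      refine ⟨f, ?_⟩
      exact congrArg (Submodule.Quotient.mk (p := Ideal.span {(Polynomial.X : k[X]) ^ _}))
        (mul_one (f : k[X]))
    · refine Iff.trans ?_ Ideal.mem_span_singleton
      refine Iff.trans ?_ (Submodule.Quotient.mk_eq_zero _)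
      refine Eq.congr ?_ rfl
      exact congrArg (Submodule.Quotient.mk (p := Ideal.span {(Polynomial.X : k[X]) ^ _}))
        (mul_one (f : k[X]))

variable (k) in
/-- The generator of the module of an arc, in degree `-b`. -/
def gen (α : Arc) : α.grMod k := α.exists_generator.choose

theorem gen_mem (α : Arc) : α.gen k ∈ (α.grMod k).grading (-α.tgtInt) :=
  α.exists_generator.choose_spec.1

theorem exists_smul_gen (α : Arc) (m : α.grMod k) : ∃ f : k[X], f • α.gen k = m :=
  α.exists_generator.choose_spec.2.1 m

theorem smul_gen_eq_zero_iff (α : Arc) (f : k[X]) : f • α.gen k = 0 ↔ α.ann k ∣ f :=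
  α.exists_generator.choose_spec.2.2 f

theorem ann_of_src_eq_bot {α : Arc} (h : α.src = ⊥) : α.ann k = 0 := by
  obtain ⟨src, tgt, lt⟩ := α
  subst h
  rfl

theorem ann_of_src_eq_coe {α : Arc} {a : ℤ} (h : α.src = a) :
    α.ann k = Polynomial.X ^ (α.tgtInt - a).toNat := by
  obtain ⟨src, tgt, lt⟩ := α
  obtain rfl : src = a := h
  rfl

theorem lt_tgtInt {α : Arc} {a : ℤ} (h : α.src = a) : a < α.tgtInt := by
  have := α.lt
  rw [h, ← coe_tgtInt] at this
  exact_mod_cast this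

theorem gen_ne_zero (α : Arc) : α.gen k ≠ 0 := by
  intro h
  have h1 := (α.smul_gen_eq_zero_iff (k := k) 1).1 (by rw [h, smul_zero])
  induction hs : α.src using WithBot.recBotCoe with
  | bot => rw [ann_of_src_eq_bot hs, zero_dvd_iff] at h1; exact one_ne_zero h1
  | coe a =>
    rw [ann_of_src_eq_coe hs] at h1
    have := Polynomial.isUnit_iff.1 (isUnit_of_dvd_one h1)
    obtain ⟨c, hc, hc'⟩ := this
    have h2 := congrArg Polynomial.natDegree hc'
    rw [Polynomial.natDegree_C, Polynomial.natDegree_X_pow] at h2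
    have := lt_tgtInt hs
    lia

/-- For a finite source `a` this is `b - a ≤ j`; written in `WithBot ℤ` it also covers `-∞`, where
no power kills the generator. -/
theorem X_pow_smul_gen_eq_zero_iff (α : Arc) (j : ℕ) :
    (Polynomial.X : k[X]) ^ j • α.gen k = 0 ↔ ((α.tgtInt - j : ℤ) : WithBot ℤ) ≤ α.src := by
  rw [smul_gen_eq_zero_iff]
  induction hs : α.src using WithBot.recBotCoe with
  | bot =>
    rw [ann_of_src_eq_bot hs, zero_dvd_iff, le_bot_iff]
    simp
  | coe a =>
    rw [ann_of_src_eq_coe hs, pow_dvd_pow_iff Polynomial.X_ne_zero Polynomial.not_isUnit_X,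
      WithBot.coe_le_coe]
    lia

theorem exists_hom {N : GrMod k} (α : Arc) {n : N} (hn : n ∈ N.grading (-α.tgtInt))
    (hann : α.ann k • n = 0) : ∃ φ : α.grMod k ⟶ N, GrMod.toLin φ (α.gen k) = n :=
  GrMod.exists_hom_of_generator α.gen_mem α.exists_smul_gen hn fun f hf ↦ by
    obtain ⟨g, rfl⟩ := (α.smul_gen_eq_zero_iff f).1 hf
    rw [mul_comm, mul_smul, hann, smul_zero]

theorem hom_ext {N : GrMod k} {α : Arc} {φ ψ : α.grMod k ⟶ N}
    (h : GrMod.toLin φ (α.gen k) = GrMod.toLin ψ (α.gen k)) : φ = ψ := by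
  ext m
  obtain ⟨f, rfl⟩ := α.exists_smul_gen m
  rw [map_smul, map_smul, h]

/-- Each graded piece is at most one-dimensional over `k`, because the module is cyclic and only one
monomial contributes in a given degree. -/
theorem mem_grading_iff (α : Arc) {i : ℤ} {m : α.grMod k} (hm : m ∈ (α.grMod k).grading i) :
    m = 0 ∨ ∃ (j : ℕ) (c : k), i = -α.tgtInt + j ∧
      m = Polynomial.C c • (Polynomial.X : k[X]) ^ j • α.gen k := by
  obtain ⟨f, rfl⟩ := α.exists_smul_gen m
  rw [← GrMod.comp_same hm]
  rcases lt_or_ge i (-α.tgtInt) with hi | hi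
  · exact .inl (GrMod.comp_smul_of_lt α.gen_mem f hi)
  · obtain ⟨j, rfl⟩ := Int.le.dest hi
    refine .inr ⟨j, f.coeff j, rfl, ?_⟩
    rw [GrMod.comp_smul_of_mem α.gen_mem, ← Polynomial.C_mul_X_pow_eq_monomial, mul_smul]

/-- `y^n` acts bijectively from degree `s` to degree `s + n` on the module of `(a, b)` as soon as
none or both of these degrees lie in `[-b, -a)`. -/
theorem bijective_X_pow_smul_iff (α : Arc) (s : ℤ) (n : ℕ) :
    Set.BijOn (fun m ↦ (Polynomial.X : k[X]) ^ n • m) ((α.grMod k).grading s : Set (α.grMod k))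
      ((α.grMod k).grading (s + n)) ↔
    ((α.src < (-s : ℤ) ∧ (-s : ℤ) ≤ α.tgt) ↔
      (α.src < (-(s + n) : ℤ) ∧ (-(s + n) : ℤ) ≤ α.tgt)) := by
  rw [← coe_tgtInt, WithBot.coe_le_coe, WithBot.coe_le_coe]
  -- `hX0` and `hX1`: the piece of degree `i` vanishes when `-i` is outside `(a, b]` and contains a
  -- nonzero `X ^ j • gen` otherwise.
  have hX0 : ∀ (i : ℤ) (m : α.grMod k), m ∈ (α.grMod k).grading i →
      ¬ (α.src < (-i : ℤ) ∧ (-i : ℤ) ≤ α.tgtInt) → m = 0 := by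
    intro i m hm hi
    rcases α.mem_grading_iff hm with h | ⟨j, c, hj, rfl⟩
    · exact h
    · rw [(α.X_pow_smul_gen_eq_zero_iff j).2, smul_zero]
      by_contra! hcon
      refine hi ⟨?_, by lia⟩
      rwa [show -i = α.tgtInt - j by lia]
  have hX1 : ∀ i : ℤ, α.src < (-i : ℤ) → (-i : ℤ) ≤ α.tgtInt →
      ∃ j : ℕ, i = -α.tgtInt + j ∧ (Polynomial.X : k[X]) ^ j • α.gen k ≠ 0 := by
    intro i h1 h2
    refine ⟨(i + α.tgtInt).toNat, by lia, fun h ↦ ?_⟩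
    rw [X_pow_smul_gen_eq_zero_iff] at h
    rw [show α.tgtInt - ((i + α.tgtInt).toNat : ℕ) = -i by lia] at h
    exact absurd h1 (not_lt.2 h)
  constructor
  · rintro ⟨-, hinj, hsurj⟩
    constructor
    · rintro ⟨h1, h2⟩
      by_contra h3
      obtain ⟨j, hj, hne⟩ := hX1 s h1 h2
      have hmem : (Polynomial.X : k[X]) ^ j • α.gen k ∈ (α.grMod k).grading s := by
        rw [hj]; exact GrMod.X_pow_smul_mem α.gen_mem j
      refine hne (hinj hmem (zero_mem _) ?_)
      simp only [smul_zero]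
      exact hX0 _ _ (GrMod.X_pow_smul_mem hmem n) h3
    · rintro ⟨h1, h2⟩
      by_contra h3
      obtain ⟨j, hj, hne⟩ := hX1 _ h1 h2
      have hmem : (Polynomial.X : k[X]) ^ j • α.gen k ∈ (α.grMod k).grading (s + n) := by
        rw [hj]; exact GrMod.X_pow_smul_mem α.gen_mem j
      obtain ⟨m, hm, hm'⟩ := hsurj hmem
      rw [hX0 s m hm h3] at hm'
      exact hne (hm'.symm.trans (smul_zero _))
  · intro h
    refine ⟨fun m hm ↦ GrMod.X_pow_smul_mem hm n, ?_, ?_⟩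
    · intro x hx y hy hxy
      rw [← sub_eq_zero]
      by_cases hs : α.src < (-s : ℤ) ∧ (-s : ℤ) ≤ α.tgtInt
      · obtain ⟨j, hj, hne⟩ := hX1 _ (h.1 hs).1 (h.1 hs).2
        rcases α.mem_grading_iff (sub_mem hx hy) with h0 | ⟨l, c, hl, hc⟩
        · exact h0
        · rw [hc]
          have h1 : (Polynomial.X : k[X]) ^ n • (x - y) = 0 := by
            rw [smul_sub, sub_eq_zero]; exact hxy
          rw [hc, smul_comm, ← mul_smul _ _ (α.gen k), ← pow_add, show n + l = j by lia] at h1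
          by_cases hc0 : c = 0
          · rw [hc0, map_zero, zero_smul]
          · refine absurd ?_ hne
            have h2 := congrArg (fun z ↦ Polynomial.C c⁻¹ • z) h1
            simpa only [smul_zero, ← mul_smul, ← mul_assoc, ← Polynomial.C_mul, inv_mul_cancel₀ hc0,
              Polynomial.C_1, one_mul] using h2
      · exact hX0 s _ (sub_mem hx hy) hs
    · intro m hm
      by_cases hs : α.src < (-s : ℤ) ∧ (-s : ℤ) ≤ α.tgtInt
      · rcases α.mem_grading_iff hm with h0 | ⟨l, c, hl, hc⟩
        · exact ⟨0, zero_mem _, by simp [h0]⟩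
        · obtain ⟨j, hj, -⟩ := hX1 _ hs.1 hs.2
          refine ⟨Polynomial.C c • (Polynomial.X : k[X]) ^ j • α.gen k, ?_, ?_⟩
          · rw [hj]; exact GrMod.C_smul_mem (GrMod.X_pow_smul_mem α.gen_mem j) c
          · simp only
            rw [smul_comm, ← mul_smul _ _ (α.gen k), ← pow_add, show n + j = l by lia, hc]
      · exact ⟨0, zero_mem _, by simp [hX0 _ m hm (fun h' ↦ hs (h.2 h'))]⟩

end Arc
end ArcModel

namespace ArcModel

/-! ### Decomposition of graded modules -/

namespace GrMod

variable {k : Type u} [Field k] {M N : GrMod k}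

/-- Transport of the elements of degrees `s, …, s + n` into degree `s + n`. -/
def transport (M : GrMod k) (s : ℤ) (n : ℕ) : M →+ M :=
  ∑ l ∈ Finset.range (n + 1),
    (DistribSMul.toAddMonoidHom M ((Polynomial.X : k[X]) ^ (n - l))).comp (M.comp (s + l))

theorem transport_apply (s : ℤ) (n : ℕ) (m : M) : M.transport s n m =
    ∑ l ∈ Finset.range (n + 1), (Polynomial.X : k[X]) ^ (n - l) • M.comp (s + l) m := by
  simp [transport]

theorem transport_of_mem {s : ℤ} {n j : ℕ} (hj : j ≤ n) {m : M} (hm : m ∈ M.grading (s + j)) :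
    M.transport s n m = (Polynomial.X : k[X]) ^ (n - j) • m := by
  rw [transport_apply, Finset.sum_eq_single j]
  · rw [comp_same hm]
  · intro l _ hl
    rw [comp_ne (fun h ↦ hl (by lia)) hm, smul_zero]
  · intro h
    exact absurd (Finset.mem_range.2 (by lia)) h

theorem transport_C_smul (s : ℤ) (n : ℕ) (c : k) (m : M) :
    M.transport s n (Polynomial.C c • m) = Polynomial.C c • M.transport s n m := by
  simp only [transport_apply, comp_C_smul, Finset.smul_sum]
  exact Finset.sum_congr rfl fun l _ ↦ smul_comm _ _ _

/-- An element `x` of lowest degree is detected by a linear functional which is invariant under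
multiplication by `X` in the range of degrees where `x` survives. -/
theorem exists_functional {s : ℤ} {x : M} (hx : x ≠ 0) (hxs : x ∈ M.grading s) :
    ∃ φ : M →+ k, (∀ (c : k) (m : M), φ (Polynomial.C c • m) = c * φ m) ∧ φ x = 1 ∧
      ∀ (j : ℕ), (Polynomial.X : k[X]) ^ (j + 1) • x ≠ 0 → ∀ m ∈ M.grading (s + j),
        φ ((Polynomial.X : k[X]) • m) = φ m := by
  let : Module k M := Module.compHom M (Polynomial.C : k →+* k[X])
  -- The relations a functional has to kill in order to be invariant; it then suffices that `x ∉ K`.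
  let K : Submodule k M := Submodule.span k
    {m | ∃ j : ℕ, (Polynomial.X : k[X]) ^ (j + 1) • x ≠ 0 ∧ ∃ z ∈ M.grading (s + j),
      (Polynomial.X : k[X]) • z - z = m}
  -- Moved into one common degree, `X • z` and `z` become equal, so every element of `K` is
  -- transported to zero in a degree where `x` still survives. As `x` is transported to `X ^ J • x`,
  -- it cannot lie in `K`.
  have hK : ∀ m ∈ K, ∃ J : ℕ, (Polynomial.X : k[X]) ^ J • x ≠ 0 ∧
      ∀ n ≥ J, (Polynomial.X : k[X]) ^ n • x ≠ 0 → M.transport s n m = 0 := by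
    intro m hm
    induction hm using Submodule.span_induction with
    | mem m hm =>
      obtain ⟨j, hj, z, hz, rfl⟩ := hm
      refine ⟨j + 1, hj, fun n hn _ ↦ ?_⟩
      have hz' : (Polynomial.X : k[X]) • z ∈ M.grading (s + (j + 1 : ℕ)) := by
        have := X_smul_mem hz
        rwa [show s + (j + 1 : ℕ) = s + j + 1 by lia]
      rw [map_sub, transport_of_mem hn hz', transport_of_mem (by lia) hz, ← mul_smul, ← pow_succ,
        show n - (j + 1) + 1 = n - j by lia, sub_self]
    | zero => exact ⟨0, by simpa using hx, fun n _ _ ↦ map_zero _⟩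
    | add a b _ _ ha hb =>
      obtain ⟨J, hJ, hJ'⟩ := ha
      obtain ⟨L, hL, hL'⟩ := hb
      refine ⟨max J L, ?_, fun n hn hn0 ↦ ?_⟩
      · rcases max_choice J L with h | h <;> rwa [h]
      · rw [map_add, hJ' n (le_of_max_le_left hn) hn0, hL' n (le_of_max_le_right hn) hn0, add_zero]
    | smul c a _ ha =>
      obtain ⟨J, hJ, hJ'⟩ := ha
      refine ⟨J, hJ, fun n hn hn0 ↦ ?_⟩
      change M.transport s n (Polynomial.C c • a) = 0
      rw [transport_C_smul, hJ' n hn hn0, smul_zero]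
  have hxK : x ∉ K := fun hxK ↦ by
    obtain ⟨J, hJ, hJ'⟩ := hK x hxK
    have := hJ' J le_rfl hJ
    rw [transport_of_mem (j := 0) (Nat.zero_le _) (by simpa using hxs)] at this
    exact hJ this
  obtain ⟨φ, hφ, hφK⟩ := Submodule.exists_le_ker_of_notMem hxK
  refine ⟨((φ x)⁻¹ • φ).toAddMonoidHom, fun c m ↦ ?_, ?_, fun j hj m hm ↦ ?_⟩
  · change (φ x)⁻¹ * φ (c • m) = c * ((φ x)⁻¹ * φ m)
    rw [map_smul, smul_eq_mul]
    ring
  · exact inv_mul_cancel₀ hφ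
  · change (φ x)⁻¹ * φ _ = (φ x)⁻¹ * φ m
    have : φ ((Polynomial.X : k[X]) • m - m) = 0 :=
      hφK (Submodule.subset_span ⟨j, hj, m, hm, rfl⟩)
    rw [map_sub, sub_eq_zero] at this
    rw [this]

/-- Every nonzero graded module has the module of an arc as a direct summand. -/
theorem exists_retract (h : ∃ m : M, m ≠ 0) : ∃ α : Arc, Nonempty (Retract (α.grMod k) M) := by
  obtain ⟨s, x, hx, hxs, hs⟩ := M.exists_lowest h
  -- The arc of the cyclic submodule generated by `x`: its length is the first power of `X` killing
  -- `x`, infinite if there is none.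
  obtain ⟨α, hαs, hα⟩ : ∃ α : Arc, -α.tgtInt = s ∧ ∀ j : ℕ,
      (Polynomial.X : k[X]) ^ j • α.gen k = 0 ↔ (Polynomial.X : k[X]) ^ j • x = 0 := by
    by_cases hfin : ∃ j : ℕ, (Polynomial.X : k[X]) ^ j • x = 0
    · classical
      have hpos : 0 < Nat.find hfin := by
        rw [Nat.pos_iff_ne_zero]
        intro h0
        have := Nat.find_spec hfin
        rw [h0, pow_zero, one_smul] at this
        exact hx this
      refine ⟨⟨((-s - Nat.find hfin : ℤ) : WithBot ℤ), ((-s : ℤ) : WithBot ℤ),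
        WithBot.coe_lt_coe.2 (by lia)⟩, neg_neg s, fun j ↦ ?_⟩
      rw [Arc.X_pow_smul_gen_eq_zero_iff, WithBot.coe_le_coe]
      change -s - (j : ℤ) ≤ -s - Nat.find hfin ↔ _
      rw [sub_le_sub_iff_left, Nat.cast_le]
      refine ⟨fun hj ↦ ?_, fun hj ↦ Nat.find_min' hfin hj⟩
      rw [← Nat.sub_add_cancel hj, pow_add, mul_smul, Nat.find_spec hfin, smul_zero]
    · refine ⟨⟨⊥, ((-s : ℤ) : WithBot ℤ), WithBot.bot_lt_coe _⟩, neg_neg s, fun j ↦ ?_⟩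
      rw [Arc.X_pow_smul_gen_eq_zero_iff, le_bot_iff]
      push Not at hfin
      simp [hfin j]
  obtain ⟨i, hi⟩ := α.exists_hom (k := k) (N := M) (n := x) (hαs ▸ hxs) (by
    induction hsrc : α.src using WithBot.recBotCoe with
    | bot => rw [Arc.ann_of_src_eq_bot hsrc, zero_smul]
    | coe a =>
      rw [Arc.ann_of_src_eq_coe hsrc, ← hα, ← Arc.ann_of_src_eq_coe hsrc,
        Arc.smul_gen_eq_zero_iff])
  obtain ⟨φ, hφC, hφx, hφX⟩ := exists_functional hx hxs
  have hgen : α.gen k ∈ (α.grMod k).grading s := hαs ▸ α.gen_mem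
  -- The retraction in degree `l`. For `l < s` the exponent defaults to `0`, harmlessly: `s` is the
  -- lowest degree of `M`, so nothing lives there.
  let ρ : ℤ → M →+ α.grMod k := fun l ↦
    { toFun := fun m ↦ Polynomial.C (φ m) • (Polynomial.X : k[X]) ^ (l - s).toNat • α.gen k
      map_zero' := by simp
      map_add' := fun a b ↦ by rw [map_add, map_add, add_smul] }
  obtain ⟨r, hr⟩ := exists_addMonoidHom_of_components ρ
  have hr' : ∀ (j : ℕ), ∀ m ∈ M.grading (s + j),
      r m = Polynomial.C (φ m) • (Polynomial.X : k[X]) ^ j • α.gen k := fun j m hm ↦ by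
    rw [hr _ m hm]
    simp [ρ]
  have hcase : ∀ (p : ℤ → Prop), (∀ l < s, p l) → (∀ j : ℕ, p (s + j)) → ∀ l, p l := by
    intro p h1 h2 l
    rcases lt_or_ge l s with hl | hl
    · exact h1 l hl
    · obtain ⟨j, rfl⟩ := Int.le.dest hl
      exact h2 j
  obtain ⟨g, hg⟩ := exists_hom_of_addMonoidHom r
    (hcase _ (fun l hl m hm ↦ by rw [hs l hl m hm, map_zero]; exact zero_mem _)
      (fun j m hm ↦ by rw [hr' j m hm]; exact C_smul_mem (X_pow_smul_mem hgen j) _))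
    (fun c ↦ hcase _ (fun l hl m hm ↦ by rw [hs l hl m hm, smul_zero, map_zero, smul_zero])
      (fun j m hm ↦ by
        rw [hr' j m hm, hr' j _ (C_smul_mem hm c), hφC, Polynomial.C_mul, mul_smul]))
    (hcase _ (fun l hl m hm ↦ by rw [hs l hl m hm, smul_zero, map_zero, smul_zero])
      (fun j m hm ↦ by
        have hm' : (Polynomial.X : k[X]) • m ∈ M.grading (s + (j + 1 : ℕ)) := by
          have := X_smul_mem hm
          rwa [show s + (j + 1 : ℕ) = s + j + 1 by lia]
        rw [hr' j m hm, hr' (j + 1) _ hm', smul_comm (Polynomial.X : k[X]),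
          ← mul_smul (Polynomial.X : k[X]) _ (α.gen k), ← pow_succ']
        -- Once `x` has died, so has the generator, and both sides vanish; before that, `φ` is
        -- invariant under `X`.
        by_cases h0 : (Polynomial.X : k[X]) ^ (j + 1) • x = 0
        · rw [(hα _).2 h0, smul_zero, smul_zero]
        · rw [hφX j h0 m hm]))
  refine ⟨α, ⟨⟨i, g, Arc.hom_ext ?_⟩⟩⟩
  rw [toLin_comp, hi, hg, hr' 0 x (by simpa using hxs), hφx]
  simp

theorem exists_iso_biprod (h : ∃ m : M, m ≠ 0) :
    ∃ (α : Arc) (N : GrMod k), Nonempty (M ≅ N ⊞ α.grMod k) := by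
  obtain ⟨α, ⟨r⟩⟩ := exists_retract h
  let S : ShortComplex (GrMod k) := ShortComplex.mk (kernel.ι r.r) r.r (kernel.condition _)
  exact ⟨α, kernel r.r, ⟨(ShortComplex.Splitting.ofExactOfSection S
    (ShortComplex.exact_kernel r.r) r.i r.retract
    (inferInstanceAs (Mono (kernel.ι r.r)))).isoBinaryBiproduct⟩⟩

/-- Induction over graded modules: each of them is an iterated direct sum of modules of arcs. -/
theorem induction_arc {p : GrMod k → Prop} (h0 : ∀ M, IsZero M → p M)
    (hiso : ∀ M N : GrMod k, (M ≅ N) → p M → p N)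
    (h : ∀ (N : GrMod k) (α : Arc), p N → p (N ⊞ α.grMod k)) (M : GrMod k) : p M := by
  -- Noetherian induction on the kernel of a quotient map `M ⟶ C`: splitting an arc module off `C`
  -- strictly enlarges the kernel.
  suffices key : ∀ (D : Submodule k[X] M) (C : GrMod k) (q : M ⟶ C) [Epi q],
      LinearMap.ker (toLin q) = D → p C from key _ M (𝟙 M) rfl
  intro D
  induction D using WellFoundedGT.induction with
  | ind D ih =>
    intro C q _ hq
    by_cases hC : ∃ m : C, m ≠ 0
    · obtain ⟨α, N, ⟨e⟩⟩ := exists_iso_biprod hC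
      refine hiso _ _ e.symm (h N α ?_)
      refine ih _ ?_ N (q ≫ e.hom ≫ biprod.fst) rfl
      -- A lift to `M` of the generator of the removed summand lies in the new kernel but not in the
      -- old one.
      have hz : toLin ((biprod.inr : α.grMod k ⟶ N ⊞ α.grMod k) ≫ e.inv) (α.gen k) ≠ 0 := by
        intro hz
        apply α.gen_ne_zero (k := k)
        have := congrArg (toLin (e.hom ≫ biprod.snd)) hz
        rw [map_zero, ← toLin_comp] at this
        simpa using this
      obtain ⟨m, hm⟩ := surjective_of_epi q
        (toLin ((biprod.inr : α.grMod k ⟶ N ⊞ α.grMod k) ≫ e.inv) (α.gen k))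
      rw [← hq]
      refine lt_of_le_of_ne (fun z hz ↦ ?_) fun heq ↦ ?_
      · rw [LinearMap.mem_ker] at hz ⊢
        rw [toLin_comp, hz, map_zero]
      · refine hz ?_
        rw [← hm, ← LinearMap.mem_ker, heq, LinearMap.mem_ker, toLin_comp, hm, ← toLin_comp]
        simp
    · push Not at hC
      exact h0 C (isZero_iff_forall_eq_zero.2 hC)

end GrMod
end ArcModel

namespace ArcModel

/-! ### Short exact sequences of modules of arcs -/

namespace Arc

variable {k : Type u} [Field k]

/-- With `q` the annihilator for `α`, up to twist this is `0 → S/(q) → S/(y^n q) → S/(y^n) → 0`,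
multiplication by `y^n` followed by the projection. The case `q = 0` is allowed. -/
theorem exists_shortExact {α β γ : Arc} (n : ℕ) (hβ : β.tgtInt = α.tgtInt + n)
    (hγ : γ.tgtInt = β.tgtInt) (hβ' : β.ann k = Polynomial.X ^ n * α.ann k)
    (hγ' : γ.ann k = Polynomial.X ^ n) :
    ∃ (f : α.grMod k ⟶ β.grMod k) (g : β.grMod k ⟶ γ.grMod k) (w : f ≫ g = 0),
      (ShortComplex.mk f g w).ShortExact := by
  have hX : (Polynomial.X : k[X]) ^ n ≠ 0 := pow_ne_zero _ Polynomial.X_ne_zero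
  obtain ⟨f, hf⟩ := α.exists_hom (k := k) (n := (Polynomial.X : k[X]) ^ n • β.gen k)
    (by
      have := GrMod.X_pow_smul_mem (β.gen_mem (k := k)) n
      rwa [show -β.tgtInt + n = -α.tgtInt by lia] at this)
    (by rw [← mul_smul, smul_gen_eq_zero_iff, hβ', mul_comm])
  obtain ⟨g, hg⟩ := β.exists_hom (k := k) (n := γ.gen k) (hγ ▸ γ.gen_mem)
    (by rw [smul_gen_eq_zero_iff, hγ', hβ']; exact dvd_mul_right _ _)
  have hf' : ∀ p : k[X], GrMod.toLin f (p • α.gen k) = (p * Polynomial.X ^ n) • β.gen k :=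
    fun p ↦ by rw [map_smul, hf, mul_smul]
  refine ⟨f, g, hom_ext ?_, GrMod.shortExact_of_toLin ?_ ?_ ?_⟩
  · rw [GrMod.toLin_comp, hf, map_smul, hg, GrMod.toLin_zero, smul_gen_eq_zero_iff, hγ']
  · rw [injective_iff_map_eq_zero]
    intro m hm
    obtain ⟨p, rfl⟩ := α.exists_smul_gen m
    change GrMod.toLin f _ = 0 at hm
    rw [hf', smul_gen_eq_zero_iff, hβ', mul_comm p, mul_dvd_mul_iff_left hX] at hm
    rwa [smul_gen_eq_zero_iff]
  · intro m
    obtain ⟨p, rfl⟩ := γ.exists_smul_gen m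
    exact ⟨p • β.gen k, (map_smul (GrMod.toLin g) p _).trans (by rw [hg])⟩
  · intro m hm
    obtain ⟨p, rfl⟩ := β.exists_smul_gen m
    change GrMod.toLin g _ = 0 at hm
    rw [map_smul, hg, smul_gen_eq_zero_iff, hγ'] at hm
    obtain ⟨q, rfl⟩ := hm
    exact ⟨q • α.gen k, by rw [hf', mul_comm]⟩

/-- With `q` the annihilator for `α`, up to twist this is `0 → S/(q) → S/(y^n) ⊕ S/(y^m q) →
S/(y^(m+n)) → 0`, with maps `(1, y^m)` and `(y^m, -1)`. -/
theorem exists_shortExact_prod {α β γ δ : Arc} (n m : ℕ) (hβ : β.tgtInt = α.tgtInt)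
    (hγ : γ.tgtInt = α.tgtInt + m) (hδ : δ.tgtInt = α.tgtInt + m)
    (hα' : Polynomial.X ^ n ∣ α.ann k) (hβ' : β.ann k = Polynomial.X ^ n)
    (hγ' : γ.ann k = Polynomial.X ^ m * α.ann k) (hδ' : δ.ann k = Polynomial.X ^ m * Polynomial.X ^ n) :
    ∃ (f : α.grMod k ⟶ (β.grMod k).prod (γ.grMod k))
      (g : (β.grMod k).prod (γ.grMod k) ⟶ δ.grMod k) (w : f ≫ g = 0),
      (ShortComplex.mk f g w).ShortExact := by
  have hX : (Polynomial.X : k[X]) ^ m ≠ 0 := pow_ne_zero _ Polynomial.X_ne_zero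
  have hmem : ∀ {ε : Arc}, ε.tgtInt = α.tgtInt + m →
      (Polynomial.X : k[X]) ^ m • ε.gen k ∈ (ε.grMod k).grading (-α.tgtInt) := fun {ε} hε ↦ by
    have := GrMod.X_pow_smul_mem (ε.gen_mem (k := k)) m
    rwa [show -ε.tgtInt + m = -α.tgtInt by lia] at this
  obtain ⟨f₁, hf₁⟩ := α.exists_hom (k := k) (n := β.gen k) (hβ ▸ β.gen_mem)
    (by rwa [smul_gen_eq_zero_iff, hβ'])
  obtain ⟨f₂, hf₂⟩ := α.exists_hom (k := k) (n := (Polynomial.X : k[X]) ^ m • γ.gen k) (hmem hγ)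
    (by rw [← mul_smul, smul_gen_eq_zero_iff, hγ', mul_comm])
  obtain ⟨g₁, hg₁⟩ := β.exists_hom (k := k) (n := (Polynomial.X : k[X]) ^ m • δ.gen k)
    (hβ ▸ hmem hδ) (by rw [← mul_smul, smul_gen_eq_zero_iff, hδ', hβ', mul_comm])
  obtain ⟨g₂, hg₂⟩ := γ.exists_hom (k := k) (n := δ.gen k) (hγ.trans hδ.symm ▸ δ.gen_mem)
    (by rw [smul_gen_eq_zero_iff, hδ', hγ']; exact mul_dvd_mul_left _ hα')
  let f : α.grMod k ⟶ (β.grMod k).prod (γ.grMod k) :=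
    GrMod.ofLin ((GrMod.toLin f₁).prod (GrMod.toLin f₂))
      fun i z hz ↦ ⟨GrMod.toLin_mem f₁ hz, GrMod.toLin_mem f₂ hz⟩
  let g : (β.grMod k).prod (γ.grMod k) ⟶ δ.grMod k :=
    GrMod.ofLin ((GrMod.toLin g₁).coprod (-GrMod.toLin g₂))
      fun i z hz ↦ add_mem (GrMod.toLin_mem g₁ hz.1) (neg_mem (GrMod.toLin_mem g₂ hz.2))
  have hf : ∀ p : k[X], GrMod.toLin f (p • α.gen k) =
      (p • β.gen k, (p * Polynomial.X ^ m) • γ.gen k) := fun p ↦ by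
    refine Prod.ext ?_ ?_
    · change GrMod.toLin f₁ _ = _
      rw [map_smul, hf₁]
    · change GrMod.toLin f₂ _ = _
      rw [map_smul, hf₂, mul_smul]
  have hg : ∀ p q : k[X], GrMod.toLin g (p • β.gen k, q • γ.gen k) =
      (p * Polynomial.X ^ m - q) • δ.gen k := fun p q ↦ by
    change GrMod.toLin g₁ (p • β.gen k) + -GrMod.toLin g₂ (q • γ.gen k) = _
    rw [map_smul, map_smul, hg₁, hg₂, sub_smul, mul_smul, sub_eq_add_neg]
  refine ⟨f, g, hom_ext ?_, GrMod.shortExact_of_toLin ?_ ?_ ?_⟩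
  · rw [GrMod.toLin_comp, ← one_smul k[X] (α.gen k), hf, hg, sub_self, zero_smul, GrMod.toLin_zero]
  · rw [injective_iff_map_eq_zero]
    intro z hz
    obtain ⟨p, rfl⟩ := α.exists_smul_gen z
    have hz : GrMod.toLin f (p • α.gen k) = 0 := hz
    rw [hf] at hz
    have hz2 : (p * Polynomial.X ^ m) • γ.gen k = 0 := congrArg Prod.snd hz
    rw [smul_gen_eq_zero_iff, hγ', mul_comm p, mul_dvd_mul_iff_left hX] at hz2
    rwa [smul_gen_eq_zero_iff]
  · intro z
    obtain ⟨p, rfl⟩ := δ.exists_smul_gen z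
    exact ⟨((0 : k[X]) • β.gen k, (-p) • γ.gen k), (hg _ _).trans (by simp)⟩
  · rintro ⟨z₁, z₂⟩ hz
    obtain ⟨p, rfl⟩ := β.exists_smul_gen z₁
    obtain ⟨q, rfl⟩ := γ.exists_smul_gen z₂
    have hz : GrMod.toLin g (p • β.gen k, q • γ.gen k) = 0 := hz
    rw [hg, smul_gen_eq_zero_iff, hδ'] at hz
    obtain ⟨h, hh⟩ := hz
    -- Subtracting `X ^ n * h` leaves the class of `p` modulo `X ^ n` unchanged and turns `p * X ^
    -- m` into exactly `q`.
    refine ⟨(p - Polynomial.X ^ n * h) • α.gen k, (hf _).trans (Prod.ext ?_ ?_)⟩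
    · change (p - Polynomial.X ^ n * h) • β.gen k = p • β.gen k
      rw [sub_smul, sub_eq_self, smul_gen_eq_zero_iff, hβ']
      exact dvd_mul_right _ _
    · change ((p - Polynomial.X ^ n * h) * Polynomial.X ^ m) • γ.gen k = q • γ.gen k
      congr 1
      linear_combination hh

section

variable {a c b d : WithBot ℤ} (hac : a < c) (hcb : c < b) (hbd : b < d)

/-- Concatenation of arcs as an extension. For `a = -∞` it is the projective resolution of the
module of `(c, b)`. -/
theorem exists_shortExact_of_lt :
    ∃ (f : (⟨a, c, hac⟩ : Arc).grMod k ⟶ (⟨a, b, hac.trans hcb⟩ : Arc).grMod k)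
      (g : (⟨a, b, hac.trans hcb⟩ : Arc).grMod k ⟶ (⟨c, b, hcb⟩ : Arc).grMod k) (w : f ≫ g = 0),
      (ShortComplex.mk f g w).ShortExact := by
  lift c to ℤ using ne_bot_of_gt hac
  lift b to ℤ using ne_bot_of_gt hcb
  have hcb' := WithBot.coe_lt_coe.1 hcb
  refine exists_shortExact (b - c).toNat (show b = c + ((b - c).toNat : ℤ) by lia) rfl ?_
    (ann_of_src_eq_coe rfl)
  induction a using WithBot.recBotCoe with
  | bot => rw [ann_of_src_eq_bot rfl, ann_of_src_eq_bot rfl, mul_zero]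
  | coe a =>
    have hac' := WithBot.coe_lt_coe.1 hac
    rw [ann_of_src_eq_coe rfl, ann_of_src_eq_coe rfl, ← pow_add]
    congr 1
    change (b - a).toNat = (b - c).toNat + (c - a).toNat
    lia

/-- For crossing arcs `(a, b)` and `(c, d)`, an extension of their modules splits into the modules
of the inner arc `(c, b)` and the outer arc `(a, d)`. -/
theorem exists_shortExact_prod_of_lt :
    ∃ (f : (⟨a, b, hac.trans hcb⟩ : Arc).grMod k ⟶ ((⟨c, b, hcb⟩ : Arc).grMod k).prod
        ((⟨a, d, (hac.trans hcb).trans hbd⟩ : Arc).grMod k))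
      (g : ((⟨c, b, hcb⟩ : Arc).grMod k).prod
        ((⟨a, d, (hac.trans hcb).trans hbd⟩ : Arc).grMod k) ⟶
        (⟨c, d, hcb.trans hbd⟩ : Arc).grMod k) (w : f ≫ g = 0),
      (ShortComplex.mk f g w).ShortExact := by
  lift c to ℤ using ne_bot_of_gt hac
  lift b to ℤ using ne_bot_of_gt hcb
  lift d to ℤ using ne_bot_of_gt hbd
  have hcb' := WithBot.coe_lt_coe.1 hcb
  have hbd' := WithBot.coe_lt_coe.1 hbd
  refine exists_shortExact_prod (b - c).toNat (d - b).toNat rfl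
    (show d = b + ((d - b).toNat : ℤ) by lia) (show d = b + ((d - b).toNat : ℤ) by lia) ?_
    (ann_of_src_eq_coe rfl) ?_ ?_
  · induction a using WithBot.recBotCoe with
    | bot => rw [ann_of_src_eq_bot rfl]; exact dvd_zero _
    | coe a =>
      have hac' := WithBot.coe_lt_coe.1 hac
      rw [ann_of_src_eq_coe rfl]
      refine pow_dvd_pow _ ?_
      change (b - c).toNat ≤ (b - a).toNat
      lia
  · induction a using WithBot.recBotCoe with
    | bot => rw [ann_of_src_eq_bot rfl, ann_of_src_eq_bot rfl, mul_zero]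
    | coe a =>
      have hac' := WithBot.coe_lt_coe.1 hac
      rw [ann_of_src_eq_coe rfl, ann_of_src_eq_coe rfl, ← pow_add]
      congr 1
      change (d - a).toNat = (d - b).toNat + (b - a).toNat
      lia
  · rw [ann_of_src_eq_coe rfl, ← pow_add]
    congr 1
    change (d - c).toNat = (d - b).toNat + (b - c).toNat
    lia

end

theorem projective_grMod {α : Arc} (h : α.src = ⊥) : Projective (α.grMod k) where
  factors {E X} f e he := by
    obtain ⟨m, hm⟩ := GrMod.surjective_of_epi e (GrMod.toLin f (α.gen k))
    have hm' : GrMod.toLin e (E.comp (-α.tgtInt) m) = GrMod.toLin f (α.gen k) := by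
      rw [← GrMod.comp_toLin, hm, GrMod.comp_same (GrMod.toLin_mem f α.gen_mem)]
    obtain ⟨φ, hφ⟩ := α.exists_hom (GrMod.comp_mem E (-α.tgtInt) m)
      (by rw [ann_of_src_eq_bot h, zero_smul])
    exact ⟨φ, hom_ext (by rw [GrMod.toLin_comp, hφ, hm'])⟩

end Arc
end ArcModel

/-! ### Vanishing of morphisms from objects of projective dimension at most one -/

namespace DerivedCategory

variable {C : Type*} [Category* C] [Abelian C] [HasDerivedCategory C]

/-- There are no nonzero morphisms from a projective object to a complex in negative degrees. -/
theorem eq_zero_of_projective (P : C) [Projective P] (Z : DerivedCategory C) [Z.IsLE (-1)]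
    (f : (singleFunctor C 0).obj P ⟶ Z) : f = 0 := by
  obtain ⟨K, hK, ⟨e⟩⟩ := exists_iso_Q_obj_of_isLE Z (-1)
  let L : CochainComplex C ℤ := (CochainComplex.singleFunctor C 0).obj P
  have : ∀ n, Projective (L.X n) := fun n ↦ by
    by_cases hn : n = 0
    · subst hn
      exact Projective.of_iso (HomologicalComplex.singleObjXSelf (.up ℤ) 0 P).symm inferInstance
    · exact Projective.of_iso
        (HomologicalComplex.isZero_single_obj_X (.up ℤ) 0 P n hn).isoZero.symm inferInstance
  -- Morphisms in the derived category out of `L` are thus homotopy classes of chain maps, and a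
  -- chain map `L ⟶ K` is zero for degree reasons.
  have : L.IsKProjective := CochainComplex.isKProjective_of_projective L 0
  let eL : (singleFunctor C 0).obj P ≅ Q.obj L := (singleFunctorIsoCompQ C 0).app P
  have hz : ∀ g : (HomotopyCategory.quotient C (.up ℤ)).obj L ⟶
      (HomotopyCategory.quotient C (.up ℤ)).obj K, g = 0 := fun g ↦ by
    obtain ⟨g, rfl⟩ := (HomotopyCategory.quotient C (.up ℤ)).map_surjective g
    have : g = 0 := by
      ext n
      by_cases hn : n = 0
      · subst hn
        exact (CochainComplex.isZero_of_isStrictlyLE K (-1) 0 (by lia)).eq_of_tgt _ _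
      · exact (HomologicalComplex.isZero_single_obj_X (.up ℤ) 0 P n hn).eq_of_src _ _
    rw [this, Functor.map_zero]
  obtain ⟨g, hg⟩ := (CochainComplex.IsKProjective.Qh_map_bijective L
    ((HomotopyCategory.quotient C (.up ℤ)).obj K)).2
    ((quotientCompQhIso C).hom.app L ≫ eL.inv ≫ f ≫ e.hom ≫ (quotientCompQhIso C).inv.app K)
  rw [hz g, Functor.map_zero] at hg
  rw [← cancel_epi eL.inv, ← cancel_mono e.hom, ← cancel_epi ((quotientCompQhIso C).hom.app L),
    ← cancel_mono ((quotientCompQhIso C).inv.app K)]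
  simpa using hg.symm

/-- An object with a projective resolution of length `1` has no nonzero morphisms to a complex in
degrees less than `-1`. -/
theorem eq_zero_of_shortExact {S : ShortComplex C} (hS : S.ShortExact) [Projective S.X₁]
    [Projective S.X₂] (Z : DerivedCategory C) [Z.IsLE (-2)]
    (f : (singleFunctor C 0).obj S.X₃ ⟶ Z) : f = 0 := by
  have : Z.IsLE (-1) := TStructure.t.isLE_of_le Z (-2) (-1) (by lia)
  have h₂ : (singleFunctor C 0).map S.g ≫ f = 0 := eq_zero_of_projective _ _ _
  -- So `f` factors through the connecting map to the shift of `S.X₁`; shifting back, `g` becomes a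
  -- map from a projective to a complex in degrees at most `-1`.
  obtain ⟨g, rfl⟩ := Triangle.yoneda_exact₃ _ hS.singleTriangle_distinguished f h₂
  have : (Z⟦(-1 : ℤ)⟧).IsLE (-1) := TStructure.t.isLE_shift Z (-2) (-1) (-1) (by lia)
  have hg : g⟦(-1 : ℤ)⟧' = 0 := by
    have := eq_zero_of_projective S.X₁ (Z⟦(-1 : ℤ)⟧)
      ((shiftFunctorCompIsoId (DerivedCategory C) (1 : ℤ) (-1) (by lia)).inv.app _ ≫ g⟦(-1 : ℤ)⟧')
    rwa [← cancel_epi ((shiftFunctorCompIsoId (DerivedCategory C) (1 : ℤ) (-1) (by lia)).inv.app _),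
      comp_zero]
  have : g = 0 := (shiftFunctor (DerivedCategory C) (-1 : ℤ)).map_injective
    (by rw [hg, Functor.map_zero])
  rw [this]
  exact comp_zero

end DerivedCategory

namespace ArcModel

/-! ### Direct summands of finite direct sums -/

section Add

variable {T : Type u} [Category.{v} T] [HasZeroObject T] [HasShift T ℤ] [Preadditive T]
  [∀ n : ℤ, (shiftFunctor T n).Additive] [Pretriangulated T] {P : ObjectProperty T}

theorem add_of_retract {X Y : T} (r : Retract X Y) (hY : add P Y) : add P X := by
  obtain ⟨n, Z, hZ, ⟨r'⟩⟩ := hY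
  exact ⟨n, Z, hZ, ⟨r.trans r'⟩⟩

theorem add_of_isZero {X : T} (hX : IsZero X) : add P X :=
  ⟨0, Fin.elim0, fun i ↦ i.elim0, ⟨⟨0, 0, hX.eq_of_src _ _⟩⟩⟩

theorem add_of_fintype {J : Type} [Fintype J] {X : T} (Y : J → T) (hY : ∀ j, P (Y j))
    (r : Retract X (⨁ Y)) : add P X :=
  ⟨Fintype.card J, Y ∘ (Fintype.equivFin J).symm, fun _ ↦ hY _,
    ⟨r.trans (Retract.ofIso (biproduct.reindex (Fintype.equivFin J).symm Y).symm)⟩⟩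

theorem add_of_prop {X : T} (hX : P X) : add P X :=
  add_of_fintype (fun _ : Unit ↦ X) (fun _ ↦ hX)
    ⟨biproduct.ι (fun _ : Unit ↦ X) (), biproduct.π _ (), by simp⟩

/-- The direct sum over a disjoint union contains the direct sums over both parts. -/
def retractBiproductSum {J K : Type} [Fintype J] [Fintype K] (W : J ⊕ K → T) :
    Retract ((⨁ fun j ↦ W (.inl j)) ⊞ ⨁ fun j ↦ W (.inr j)) (⨁ W) where
  i := biprod.desc (biproduct.desc fun j ↦ biproduct.ι W (.inl j))
    (biproduct.desc fun j ↦ biproduct.ι W (.inr j))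
  r := biprod.lift (biproduct.lift fun j ↦ biproduct.π W (.inl j))
    (biproduct.lift fun j ↦ biproduct.π W (.inr j))
  retract := by
    classical
    ext i j
    · by_cases hij : i = j
      · subst hij; simp
      · have : (Sum.inl i : J ⊕ K) ≠ .inl j := fun h ↦ hij (Sum.inl_injective h)
        simp [biproduct.ι_π_ne _ this, biproduct.ι_π_ne _ hij]
    · simp [biproduct.ι_π_ne W (Sum.inl_ne_inr (a := _) (b := _))]
    · simp [biproduct.ι_π_ne W (Sum.inr_ne_inl (a := _) (b := _))]
    · by_cases hij : i = j
      · subst hij; simp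
      · have : (Sum.inr i : J ⊕ K) ≠ .inr j := fun h ↦ hij (Sum.inr_injective h)
        simp [biproduct.ι_π_ne _ this, biproduct.ι_π_ne _ hij]

theorem add_biprod {X₁ X₂ : T} (h₁ : add P X₁) (h₂ : add P X₂) : add P (X₁ ⊞ X₂) := by
  obtain ⟨n, Y, hY, ⟨r⟩⟩ := h₁
  obtain ⟨m, Z, hZ, ⟨s⟩⟩ := h₂
  have t : Retract (X₁ ⊞ X₂) ((⨁ Y) ⊞ (⨁ Z)) :=
    ⟨biprod.map r.i s.i, biprod.map r.r s.r, by ext <;> simp⟩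
  exact add_of_fintype (Sum.elim Y Z) (Sum.rec hY hZ)
    (t.trans (retractBiproductSum (Sum.elim Y Z)))

end Add

variable {k : Type u} [Field k]

open DerivedCategory

/-! ### Vanishing of morphisms -/

/-- The category `gr S` is hereditary: summand by summand, an arc module is free or has a free
resolution of length one. -/
theorem singleFunctor_hom_eq_zero (M : GrMod k) (Z : DerivedCategory (GrMod k)) [Z.IsLE (-2)]
    (f : (singleFunctor (GrMod k) 0).obj M ⟶ Z) : f = 0 := by
  induction M using GrMod.induction_arc with
  | h0 M hM => exact (Functor.map_isZero _ hM).eq_of_src _ _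
  | hiso M N e h =>
    rw [← cancel_epi ((singleFunctor (GrMod k) 0).map e.hom), comp_zero]
    exact h _
  | h N α h =>
    have h₂ : (singleFunctor (GrMod k) 0).map biprod.inr ≫ f = 0 := by
      obtain ⟨src, tgt, lt⟩ := α
      induction src using WithBot.recBotCoe with
      | bot =>
        have := TStructure.t.isLE_of_le Z (-2) (-1) (by lia)
        have := Arc.projective_grMod (k := k) (α := ⟨⊥, tgt, lt⟩) rfl
        exact eq_zero_of_projective _ _ _
      | coe a =>
        obtain ⟨i, p, w, hS⟩ := Arc.exists_shortExact_of_lt (k := k) (WithBot.bot_lt_coe a) lt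
        have : Projective (ShortComplex.mk i p w).X₁ :=
          Arc.projective_grMod (α := ⟨⊥, _, _⟩) rfl
        have : Projective (ShortComplex.mk i p w).X₂ :=
          Arc.projective_grMod (α := ⟨⊥, _, _⟩) rfl
        exact eq_zero_of_shortExact hS _ _
    have h₁ := h ((singleFunctor (GrMod k) 0).map biprod.inl ≫ f)
    have key : f = (singleFunctor (GrMod k) 0).map
        (biprod.fst ≫ biprod.inl + biprod.snd ≫ biprod.inr) ≫ f := by
      rw [biprod.total, CategoryTheory.Functor.map_id, Category.id_comp]
    rw [key, Functor.map_add, Functor.map_comp, Functor.map_comp, Preadditive.add_comp,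
      Category.assoc, Category.assoc, h₁, h₂, comp_zero, comp_zero, add_zero]

/-! ### Decomposition of complexes -/

variable (k) in
/-- The functor sending a graded module to its stalk complex in degree `0`. -/
def stalkFunctor : GrMod k ⥤ Db k :=
  ObjectProperty.lift _ (singleFunctor (GrMod k) 0) fun M ↦ (stalk M).property

instance : (stalkFunctor k).Additive where
  map_add {M N f g} := Bounded.ι.map_injective (by
    rw [Bounded.ι.map_add]
    exact (singleFunctor (GrMod k) 0).map_add)

theorem stalk_hom_eq_zero (M : GrMod k) (Z : Db k) [Z.obj.IsLE (-2)] (f : stalk M ⟶ Z) : f = 0 :=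
  Bounded.ι.map_injective (by
    rw [Functor.map_zero]
    exact singleFunctor_hom_eq_zero M Z.obj _)

/-- The bounded t-structure. -/
abbrev tDb : Triangulated.TStructure (Db k) := TStructure.t.onBounded

instance (Z : Db k) (n : ℤ) [h : tDb.IsLE Z n] : Z.obj.IsLE n :=
  (ObjectProperty.tStructure_isLE_iff _ _ Z n).1 h

instance (Z : Db k) (n : ℤ) [h : tDb.IsGE Z n] : Z.obj.IsGE n :=
  (ObjectProperty.tStructure_isGE_iff _ _ Z n).1 h

theorem stalk_shift_hom_eq_zero (M : GrMod k) (n : ℤ) (Z : Db k) [tDb.IsLE Z (n - 2)]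
    (f : (stalk M)⟦-n⟧ ⟶ Z) : f = 0 := by
  have : tDb.IsLE (Z⟦n⟧) (-2) := tDb.isLE_shift Z (n - 2) n (-2) (by lia)
  refine (shiftFunctor (Db k) n).map_injective ?_
  have h := stalk_hom_eq_zero M (Z⟦n⟧)
    ((shiftFunctorCompIsoId (Db k) (-n) n (by lia)).inv.app _ ≫ f⟦n⟧')
  rw [Functor.map_zero]
  rwa [← cancel_epi ((shiftFunctorCompIsoId (Db k) (-n) n (by lia)).inv.app _), comp_zero]

/-- A complex concentrated in one degree is a shifted graded module. -/
theorem exists_iso_stalk_shift (X : Db k) (n : ℤ) [tDb.IsLE X n] [tDb.IsGE X n] :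
    ∃ M : GrMod k, Nonempty (X ≅ (stalk M)⟦-n⟧) := by
  obtain ⟨M, ⟨e⟩⟩ := exists_iso_singleFunctor_obj_of_isGE_of_isLE X.obj n
  refine ⟨M, ⟨ObjectProperty.isoMk _ (e ≪≫ ?_)⟩⟩
  exact ((singleFunctors (GrMod k)).shiftIso (-n) n 0 (by lia)).symm.app M ≪≫
    (Bounded.ι.commShiftIso (-n)).symm.app (stalk M)

/-- A complex is the direct sum of shifted modules of arcs: whenever it lies in a subcategory `Q`
closed under shifts and summands, it is a summand of a sum of shifted modules of arcs in `Q`. -/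
def Decomposes (X : Db k) : Prop :=
  ∀ (Q : ObjectProperty (Db k)) [Q.IsStableUnderRetracts] [Q.IsStableUnderShift ℤ],
    Q X → tau k (sigma k Q) X

theorem Decomposes.of_isZero {X : Db k} (hX : IsZero X) : Decomposes X :=
  fun _ _ _ _ ↦ add_of_isZero hX

/-- Both summands lie in every `Q` containing `X`, as `Q` is closed under retracts, and `add` is
closed under direct sums. -/
theorem Decomposes.of_total {X Y Z : Db k} (r : Retract Y X) (s : Retract Z X)
    (h : r.r ≫ r.i + s.r ≫ s.i = 𝟙 X) (hY : Decomposes Y) (hZ : Decomposes Z) :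
    Decomposes X := fun Q _ _ hX ↦
  add_of_retract ⟨biprod.lift r.r s.r, biprod.desc r.i s.i, by simpa using h⟩
    (add_biprod (hY Q (Q.prop_of_retract r hX)) (hZ Q (Q.prop_of_retract s hX)))

theorem Decomposes.of_iso {X Y : Db k} (e : X ≅ Y) (hX : Decomposes X) : Decomposes Y :=
  fun Q _ _ hY ↦ add_of_retract (Retract.ofIso e.symm)
    (hX Q (Q.prop_of_retract (Retract.ofIso e) hY))

theorem Decomposes.stalk_shift (M : GrMod k) (l : ℤ) : Decomposes ((stalk M)⟦l⟧) := by
  induction M using GrMod.induction_arc with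
  | h0 M hM =>
    exact .of_isZero (Functor.map_isZero (stalkFunctor k ⋙ shiftFunctor (Db k) l) hM)
  | hiso M N e h => exact h.of_iso ((stalkFunctor k ⋙ shiftFunctor (Db k) l).mapIso e)
  | h N α h =>
    let F := stalkFunctor k ⋙ shiftFunctor (Db k) l
    refine Decomposes.of_total (Y := F.obj N) (Z := F.obj (α.grMod k))
      (Retract.map ⟨biprod.inl, biprod.fst, by simp⟩ F)
      (Retract.map ⟨biprod.inr, biprod.snd, by simp⟩ F) ?_ h ?_
    · have : F.map (biprod.fst ≫ biprod.inl + biprod.snd ≫ biprod.inr) = 𝟙 (F.obj (N ⊞ α.grMod k)) := by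
        rw [biprod.total, F.map_id]
      rw [F.map_add, F.map_comp, F.map_comp] at this
      exact this
    · intro Q _ _ hQ
      refine add_of_prop ⟨l, α, ?_, rfl⟩
      -- Undoing the shift by `l` shows that `α` itself is an arc of `Q`.
      exact Q.prop_of_retract
        (Retract.ofIso ((shiftFunctorCompIsoId (Db k) l (-l) (by lia)).symm.app _))
        (Q.le_shift (-l) _ hQ)

theorem Decomposes.of_distinguished {T : Triangle (Db k)} (hT : T ∈ distTriang (Db k))
    (h : T.mor₃ = 0) (h₁ : Decomposes T.obj₁) (h₃ : Decomposes T.obj₃) : Decomposes T.obj₂ := by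
  obtain ⟨e, -, -⟩ := exists_iso_binaryBiproduct_of_distTriang T hT h
  exact (Decomposes.of_total ⟨biprod.inl, biprod.fst, by simp⟩ ⟨biprod.inr, biprod.snd, by simp⟩
    biprod.total h₁ h₃).of_iso e.symm

/-- Induction on the number of degrees: the top cohomology splits off, since the connecting map of
the truncation triangle `A ⟶ X ⟶ B ⟶ A⟦1⟧` goes from a stalk in degree `a + n + 1` to a complex in
degrees at least two lower. -/
theorem Decomposes.of_isGE_of_isLE (a : ℤ) (n : ℕ) (X : Db k) [tDb.IsGE X a]
    [tDb.IsLE X (a + n)] : Decomposes X := by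
  induction n generalizing X with
  | zero =>
    have : tDb.IsLE X a := by simpa using (inferInstance : tDb.IsLE X (a + (0 : ℕ)))
    obtain ⟨M, ⟨e⟩⟩ := exists_iso_stalk_shift X a
    exact (Decomposes.stalk_shift M _).of_iso e.symm
  | succ n ih =>
    have : tDb.IsLE X (a + n + 1) := by
      simpa [add_assoc] using (inferInstance : tDb.IsLE X (a + (n + 1 : ℕ)))
    obtain ⟨A, B, hA, hB, f, g, h, hT⟩ := tDb.exists_triangle X (a + n) (a + n + 1) rfl
    have : tDb.IsLE A (a + n) := ⟨hA⟩
    have : tDb.IsGE B (a + n + 1) := ⟨hB⟩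
    have : tDb.IsLE (A⟦(1 : ℤ)⟧) (a + n + 1 - 2) := tDb.isLE_shift A (a + n) 1 _ (by lia)
    -- The missing bounds come from rotating the triangle: `A` sits between `B⟦-1⟧` and `X`, and `B`
    -- between `X` and `A⟦1⟧`.
    have : tDb.IsGE (B⟦(-1 : ℤ)⟧) a :=
      have := tDb.isGE_shift B (a + n + 1) (-1) (a + n + 2) (by lia)
      tDb.isGE_of_ge _ a (a + n + 2) (by lia)
    have : tDb.IsLE (A⟦(1 : ℤ)⟧) (a + n + 1) := tDb.isLE_of_le _ (a + n + 1 - 2) _ (by lia)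
    have : tDb.IsGE A a := tDb.isGE₂ _ (inv_rot_of_distTriang _ hT) a
      (by assumption) (by assumption)
    have : tDb.IsLE B (a + n + 1) := tDb.isLE₂ _ (rot_of_distTriang _ hT) (a + n + 1)
      (by assumption) (by assumption)
    obtain ⟨M, ⟨e⟩⟩ := exists_iso_stalk_shift B (a + n + 1)
    refine Decomposes.of_distinguished hT ?_ (ih A) ((Decomposes.stalk_shift M _).of_iso e.symm)
    change h = 0
    rw [← cancel_epi e.inv, comp_zero]
    exact stalk_shift_hom_eq_zero M _ _ _

theorem decomposes (X : Db k) : Decomposes X := by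
  obtain ⟨⟨a, ha⟩, ⟨b, hb⟩⟩ := X.property
  have : tDb.IsGE X a := (ObjectProperty.tStructure_isGE_iff _ _ X a).2 ha
  have : tDb.IsLE X (a + (b - a).toNat) := (ObjectProperty.tStructure_isLE_iff _ _ X _).2
    (TStructure.t.isLE_of_le X.obj b _ (by lia))
  exact Decomposes.of_isGE_of_isLE a (b - a).toNat X

end ArcModel

namespace ArcModel

/-! ### Multiplication by powers of `y` on cohomology -/

namespace GrMod

variable {k : Type u} [Field k] {M N : GrMod k}

/-- The degree `i` part of a morphism. -/
def degMap (f : M ⟶ N) (i : ℤ) : M.grading i →+ N.grading i :=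
  ((toLin f).toAddMonoidHom.comp (M.grading i).subtype).codRestrict (N.grading i)
    fun m ↦ toLin_mem f m.2

@[simp] theorem coe_degMap (f : M ⟶ N) (i : ℤ) (m : M.grading i) :
    (degMap f i m : N) = toLin f m := rfl

/-- Multiplication by `X ^ n` from degree `s` to degree `s + n`. -/
def mulPow (M : GrMod k) (s : ℤ) (n : ℕ) : M.grading s →+ M.grading (s + n) :=
  ((DistribSMul.toAddMonoidHom M ((Polynomial.X : k[X]) ^ n)).comp
    (M.grading s).subtype).codRestrict (M.grading (s + n)) fun m ↦ X_pow_smul_mem m.2 n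

@[simp] theorem coe_mulPow (s : ℤ) (n : ℕ) (m : M.grading s) :
    (M.mulPow s n m : M) = (Polynomial.X : k[X]) ^ n • (m : M) := rfl

theorem degMap_comp_mulPow (f : M ⟶ N) (s : ℤ) (n : ℕ) :
    (degMap f (s + n)).comp (M.mulPow s n) = (N.mulPow s n).comp (degMap f s) := by
  ext m
  simp

theorem degMap_mulPow (f : M ⟶ N) (s : ℤ) (n : ℕ) (m : M.grading s) :
    degMap f (s + n) (M.mulPow s n m) = N.mulPow s n (degMap f s m) :=
  DFunLike.congr_fun (degMap_comp_mulPow f s n) m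

theorem exact_degMap {S : ShortComplex (GrMod k)} (hS : S.Exact) (i : ℤ) :
    Function.Exact (degMap S.f i) (degMap S.g i) := by
  intro m
  constructor
  · intro hm
    obtain ⟨x, hx, hx'⟩ := exists_homogeneous_of_exact hS m.2 (congrArg Subtype.val hm)
    exact ⟨⟨x, hx⟩, Subtype.ext hx'⟩
  · rintro ⟨x, rfl⟩
    ext
    simp [← toLin_comp]

theorem bijective_mulPow_of_retract (r : Retract M N) {s : ℤ} {n : ℕ}
    (h : Function.Bijective (N.mulPow s n)) : Function.Bijective (M.mulPow s n) := by
  have hr : ∀ i (m : M.grading i), degMap r.r i (degMap r.i i m) = m := fun i m ↦ by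
    ext
    simp [← toLin_comp]
  constructor
  · intro x y hxy
    rw [← hr _ x, ← hr _ y]
    congr 1
    apply h.1
    rw [← degMap_mulPow, ← degMap_mulPow, hxy]
  · intro m
    obtain ⟨z, hz⟩ := h.2 (degMap r.i _ m)
    exact ⟨degMap r.r _ z, by rw [← degMap_mulPow, hz, hr]⟩

theorem bijective_mulPow_of_isZero (h : IsZero M) (s : ℤ) (n : ℕ) :
    Function.Bijective (M.mulPow s n) := by
  rw [isZero_iff_forall_eq_zero] at h
  exact ⟨fun x y _ ↦ Subtype.ext ((h _).trans (h _).symm),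
    fun m ↦ ⟨0, Subtype.ext ((h _).trans (h _).symm)⟩⟩

theorem bijective_mulPow_iff (s : ℤ) (n : ℕ) : Function.Bijective (M.mulPow s n) ↔
    Set.BijOn (fun m ↦ (Polynomial.X : k[X]) ^ n • m) (M.grading s : Set M)
      (M.grading (s + n)) := by
  constructor
  · refine fun h ↦ ⟨fun m hm ↦ X_pow_smul_mem hm n, fun x hx y hy hxy ↦ ?_, fun m hm ↦ ?_⟩
    · exact congrArg Subtype.val (@h.1 ⟨x, hx⟩ ⟨y, hy⟩ (Subtype.ext hxy))
    · obtain ⟨z, hz⟩ := h.2 ⟨m, hm⟩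
      exact ⟨z, z.2, congrArg Subtype.val hz⟩
  · rintro ⟨-, hinj, hsurj⟩
    refine ⟨fun x y hxy ↦ Subtype.ext (hinj x.2 y.2 (congrArg Subtype.val hxy)), fun m ↦ ?_⟩
    obtain ⟨z, hz, hz'⟩ := hsurj m.2
    exact ⟨⟨z, hz⟩, Subtype.ext hz'⟩

end GrMod

variable {k : Type u} [Field k]

open DerivedCategory

variable (k) in
/-- The complexes on whose cohomology `y^n` acts bijectively out of degree `s`, for almost all
terms `(s, n)` of a sequence. -/
def test (f : ℕ → ℤ × ℕ) : ObjectProperty (Db k) := fun X ↦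
  ∀ n : ℤ, ∀ᶠ j in Filter.atTop,
    Function.Bijective (((homologyFunctor (GrMod k) n).obj X.obj).mulPow (f j).1 (f j).2)

instance (f : ℕ → ℤ × ℕ) : (test k f).IsStableUnderRetracts where
  of_retract r hY n := (hY n).mono fun _ hj ↦
    GrMod.bijective_mulPow_of_retract (r.map (Bounded.ι ⋙ homologyFunctor (GrMod k) n)) hj

/-- The cohomology of a shift. -/
def homologyShiftIso (X : Db k) (n m : ℤ) :
    (homologyFunctor (GrMod k) (n + m)).obj X.obj ≅
      (homologyFunctor (GrMod k) m).obj (X⟦n⟧).obj :=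
  ((((homologyFunctor (GrMod k) 0).shiftIso n m (n + m) rfl).app X.obj).symm) ≪≫
    ((homologyFunctor (GrMod k) m).mapIso ((Bounded.ι.commShiftIso n).app X)).symm

/-- For cones, `y^n` maps the degree `s` part of the long exact cohomology sequence to its degree `s
+ n` part, and the five lemma applies. It involves four neighbouring terms, so "for almost all `j`"
survives. -/
instance (f : ℕ → ℤ × ℕ) : (test k f).IsTriangulated where
  exists_zero := ⟨_, (isZero_zero (Db k)), fun n ↦ .of_forall fun j ↦
    GrMod.bijective_mulPow_of_isZero
      (Functor.map_isZero (Bounded.ι ⋙ homologyFunctor (GrMod k) n) (isZero_zero (Db k))) _ _⟩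
  isStableUnderShiftBy n := ⟨fun X hX m ↦ (hX (n + m)).mono fun _ hj ↦
    GrMod.bijective_mulPow_of_retract (Retract.ofIso (homologyShiftIso X n m).symm) hj⟩
  ext₂' D hD h₁ h₃ := ObjectProperty.le_isoClosure _ _ fun n ↦ by
    have hD' := Bounded.ι.map_distinguished D hD
    filter_upwards [h₃ (n - 1), h₁ n, h₃ n, h₁ (n + 1)] with j e₁ e₂ e₄ e₅
    have x₁ := HomologySequence.exact₁ _ hD' (n - 1) n (by lia)
    have x₂ := HomologySequence.exact₂ _ hD' n
    have x₃ := HomologySequence.exact₃ _ hD' n (n + 1) (by lia)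
    exact AddMonoidHom.bijective_of_surjective_of_bijective_of_bijective_of_injective
      _ _ _ _ _ _ _ _ (GrMod.mulPow _ _ _) (GrMod.mulPow _ _ _) (GrMod.mulPow _ _ _)
      (GrMod.mulPow _ _ _) (GrMod.mulPow _ _ _)
      (GrMod.degMap_comp_mulPow _ _ _) (GrMod.degMap_comp_mulPow _ _ _)
      (GrMod.degMap_comp_mulPow _ _ _) (GrMod.degMap_comp_mulPow _ _ _)
      (GrMod.exact_degMap x₁ _) (GrMod.exact_degMap x₂ _) (GrMod.exact_degMap x₃ _)
      (GrMod.exact_degMap x₁ _) (GrMod.exact_degMap x₂ _) (GrMod.exact_degMap x₃ _)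
      e₁.2 e₂ e₄ e₅.1

theorem isZero_homology_stalk (M : GrMod k) {n : ℤ} (hn : n ≠ 0) :
    IsZero ((homologyFunctor (GrMod k) n).obj (stalk M).obj) := by
  change IsZero ((homologyFunctor (GrMod k) n).obj ((singleFunctor (GrMod k) 0).obj M))
  rcases lt_or_gt_of_ne hn with h | h
  · exact isZero_of_isGE _ 0 n h
  · exact isZero_of_isLE _ 0 n h

/-- The cohomology of a stalk complex. -/
def homologyStalkIso (M : GrMod k) :
    (homologyFunctor (GrMod k) 0).obj (stalk M).obj ≅ M :=
  (singleFunctorCompHomologyFunctorIso (GrMod k) 0).app M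

/-- Turns a test on an arc module into a condition on the endpoints of the arc; only cohomology in
degree `0` matters. -/
theorem test_stalk_iff (f : ℕ → ℤ × ℕ) (α : Arc) : test k f (stalk (α.grMod k)) ↔
    ∀ᶠ j in Filter.atTop, ((α.src < (-(f j).1 : ℤ) ∧ (-(f j).1 : ℤ) ≤ α.tgt) ↔
      (α.src < (-((f j).1 + (f j).2) : ℤ) ∧ (-((f j).1 + (f j).2) : ℤ) ≤ α.tgt)) := by
  simp only [← α.bijective_X_pow_smul_iff (k := k), ← GrMod.bijective_mulPow_iff]
  constructor
  · intro h
    exact (h 0).mono fun _ hj ↦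
      GrMod.bijective_mulPow_of_retract (Retract.ofIso (homologyStalkIso _).symm) hj
  · intro h n
    by_cases hn : n = 0
    · subst hn
      exact h.mono fun _ hj ↦
        GrMod.bijective_mulPow_of_retract (Retract.ofIso (homologyStalkIso _)) hj
    · exact .of_forall fun j ↦ GrMod.bijective_mulPow_of_isZero (isZero_homology_stalk _ hn) _ _

end ArcModel

namespace ArcModel

/-! ### Separating an arc from a saturated set -/

/-- A set of arcs as a relation on endpoints. -/
def Arc.Rel (U : Set Arc) (x y : WithBot ℤ) : Prop := ∃ h : x < y, (⟨x, y, h⟩ : Arc) ∈ U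

namespace Arc

variable {U : Set Arc} {a b c d p q x y : WithBot ℤ}

theorem Rel.lt (h : Rel U x y) : x < y := h.1

theorem IsSaturated.rel (hU : IsSaturated U) (h₁ : Rel U a b) (h₂ : Rel U c d) (hac : a ≤ c)
    (hcb : c ≤ b) (hbd : b ≤ d) :
    (a < c → Rel U a c) ∧ (c < b → Rel U c b) ∧ (b < d → Rel U b d) ∧ (a < d → Rel U a d) :=
  have := hU h₁.1 h₂.1 h₁.2 h₂.2 hac hcb hbd
  ⟨fun h ↦ ⟨h, this.1 h⟩, fun h ↦ ⟨h, this.2.1 h⟩, fun h ↦ ⟨h, this.2.2.1 h⟩,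
    fun h ↦ ⟨h, this.2.2.2 h⟩⟩

/-- The endpoints connected to `q` by an arc of `U`. -/
def block (U : Set Arc) (q : WithBot ℤ) : Set (WithBot ℤ) :=
  {x | x = q ∨ Rel U x q ∨ Rel U q x}

/-- Two arcs sharing the endpoint `q` always satisfy the hypotheses of saturation, which then joins
their other ends. With the next lemma: blocks are equivalence classes. -/
theorem IsSaturated.rel_of_mem_block (hU : IsSaturated U) (hx : x ∈ block U q)
    (hy : y ∈ block U q) (hxy : x < y) : Rel U x y := by
  rcases hx with rfl | hx | hx <;> rcases hy with rfl | hy | hy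
  · exact absurd hxy (lt_irrefl _)
  · exact absurd (hxy.trans hy.lt) (lt_irrefl _)
  · exact hy
  · exact hx
  · exact (hU.rel hx hy hxy.le hy.lt.le le_rfl).1 hxy
  · exact (hU.rel hx hy hx.lt.le le_rfl hy.lt.le).2.2.2 hxy
  · exact absurd (hxy.trans hx.lt) (lt_irrefl _)
  · exact absurd ((hxy.trans hy.lt).trans hx.lt) (lt_irrefl _)
  · exact (hU.rel hx hy le_rfl hx.lt.le hxy.le).2.2.1 hxy

theorem IsSaturated.mem_block_iff (hU : IsSaturated U) (h : Rel U x y) :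
    x ∈ block U q ↔ y ∈ block U q := by
  constructor
  · rintro (rfl | hx | hx)
    · exact .inr (.inr h)
    · rcases lt_trichotomy y q with hyq | rfl | hyq
      · exact .inr (.inl ((hU.rel h hx le_rfl h.lt.le hyq.le).2.2.1 hyq))
      · exact .inl rfl
      · exact .inr (.inr ((hU.rel hx h le_rfl hx.lt.le hyq.le).2.2.1 hyq))
    · exact .inr (.inr ((hU.rel hx h hx.lt.le le_rfl h.lt.le).2.2.2 (hx.lt.trans h.lt)))
  · rintro (rfl | hy | hy)
    · exact .inr (.inl h)
    · exact .inr (.inl ((hU.rel h hy h.lt.le le_rfl hy.lt.le).2.2.2 (h.lt.trans hy.lt)))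
    · rcases lt_trichotomy x q with hxq | rfl | hxq
      · exact .inr (.inl ((hU.rel h hy hxq.le hy.lt.le le_rfl).1 hxq))
      · exact .inl rfl
      · exact .inr (.inr ((hU.rel hy h hxq.le h.lt.le le_rfl).1 hxq))

/-- An arc outside a saturated set is separated from it by an interval of integers. -/
theorem IsSaturated.exists_ordConnected (hU : IsSaturated U) (hpq : p < q) (h : ¬ Rel U p q) :
    ∃ J : Set (WithBot ℤ), J.OrdConnected ∧ ⊥ ∉ J ∧ (∀ x y, Rel U x y → (x ∈ J ↔ y ∈ J)) ∧
      ¬ (p ∈ J ↔ q ∈ J) := by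
  set B := block U q with hB
  have hqB : q ∈ B := .inl rfl
  have hpB : p ∉ B := fun hp ↦ h (hU.rel_of_mem_block hp hqB hpq)
  have hBU : ∀ {x y}, Rel U x y → (x ∈ B ↔ y ∈ B) := fun h ↦ hU.mem_block_iff h
  have hBr : ∀ {x y}, x ∈ B → y ∈ B → x < y → Rel U x y :=
    fun hx hy hxy ↦ hU.rel_of_mem_block hx hy hxy
  -- If the block `B` of `q` reaches below `p`, then `p` lies in a bounded gap of `B`, and `J` is
  -- that gap. Otherwise `J` is the convex hull of `B`, which lies strictly above `p`. Either way
  -- `-∞ ∉ J`.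
  by_cases hhull : ∃ b ∈ B, b < p
  · obtain ⟨b₀, hb₀, hb₀p⟩ := hhull
    refine ⟨{x | ∀ b ∈ B, ¬ (x ≤ b ∧ b ≤ p) ∧ ¬ (p ≤ b ∧ b ≤ x)}, ⟨?_⟩, ?_, fun x y hxy ↦ ?_, ?_⟩
    · intro x hx y hy z hz b hb
      have h1 := hx b hb
      have h2 := hy b hb
      exact ⟨fun h ↦ h1.1 ⟨hz.1.trans h.1, h.2⟩, fun h ↦ h2.2 ⟨h.1, h.2.trans hz.2⟩⟩
    · intro hbot
      exact (hbot b₀ hb₀).1 ⟨bot_le, hb₀p.le⟩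
    · have hxB : x ∈ B → ¬ ∀ b ∈ B, ¬ (x ≤ b ∧ b ≤ p) ∧ ¬ (p ≤ b ∧ b ≤ x) := fun hx h ↦
        (le_total x p).elim (fun h' ↦ (h x hx).1 ⟨le_rfl, h'⟩) fun h' ↦ (h x hx).2 ⟨h', le_rfl⟩
      have hyB : y ∈ B → ¬ ∀ b ∈ B, ¬ (y ≤ b ∧ b ≤ p) ∧ ¬ (p ≤ b ∧ b ≤ y) := fun hy h ↦
        (le_total y p).elim (fun h' ↦ (h y hy).1 ⟨le_rfl, h'⟩) fun h' ↦ (h y hy).2 ⟨h', le_rfl⟩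
      by_cases hx : x ∈ B
      · exact ⟨fun h ↦ absurd h (hxB hx), fun h ↦ absurd h (hyB ((hBU hxy).1 hx))⟩
      have hy : y ∉ B := fun hy ↦ hx ((hBU hxy).2 hy)
      have hlt := hxy.lt
      constructor
      · intro hxJ b hb
        have hbx : b ≠ x := fun h ↦ hx (h ▸ hb)
        have hby : b ≠ y := fun h ↦ hy (h ▸ hb)
        refine ⟨fun ⟨h1, h2⟩ ↦ (hxJ b hb).1 ⟨hlt.le.trans h1, h2⟩, fun ⟨h1, h2⟩ ↦ ?_⟩
        have hxb : x < b := by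
          by_contra! hcon
          exact (hxJ b hb).2 ⟨h1, hcon⟩
        -- If `(x, y)` left the gap over `b`, it would cross the arc `(b₀, b)`, and saturation would
        -- put `x` into `B`.
        have hb₀x : b₀ < x := by
          by_contra! hcon
          exact (hxJ b₀ hb₀).1 ⟨hcon, hb₀p.le⟩
        have := (hU.rel (hBr hb₀ hb (hb₀x.trans hxb)) hxy hb₀x.le hxb.le h2).1 hb₀x
        exact hx ((hBU this).1 hb₀)
      · intro hyJ b hb
        have hbx : b ≠ x := fun h ↦ hx (h ▸ hb)
        have hby : b ≠ y := fun h ↦ hy (h ▸ hb)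
        refine ⟨fun ⟨h1, h2⟩ ↦ ?_, fun ⟨h1, h2⟩ ↦ (hyJ b hb).2 ⟨h1, h2.trans hlt.le⟩⟩
        have hby : b < y := by
          by_contra! hcon
          exact (hyJ b hb).1 ⟨hcon, h2⟩
        -- Mirror image: `(x, y)` entering the gap over `b` crosses `(b, q)`, which would put `y`
        -- into `B`.
        have hyq : y < q := by
          by_contra! hcon
          exact (hyJ q hqB).2 ⟨hpq.le, hcon⟩
        have := (hU.rel hxy (hBr hb hqB (hby.trans hyq)) h1 hby.le hyq.le).2.2.1 hyq
        exact hy ((hBU this).2 hqB)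
    · intro hiff
      refine (hiff.1 (fun b hb ↦ ?_) q hqB).2 ⟨hpq.le, le_rfl⟩
      have hbp : b ≠ p := fun h ↦ hpB (h ▸ hb)
      exact ⟨fun h ↦ hbp (le_antisymm h.2 h.1), fun h ↦ hbp (le_antisymm h.2 h.1)⟩
  · push Not at hhull
    have hhull' : ∀ b ∈ B, p < b := fun b hb ↦
      lt_of_le_of_ne (hhull b hb) fun h ↦ hpB (h ▸ hb)
    refine ⟨{x | ∃ b₁ ∈ B, ∃ b₂ ∈ B, b₁ ≤ x ∧ x ≤ b₂}, ⟨?_⟩, ?_, fun x y hxy ↦ ?_, ?_⟩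
    · rintro x ⟨b₁, hb₁, -, -, h1, -⟩ y ⟨-, -, b₂, hb₂, -, h2⟩ z hz
      exact ⟨b₁, hb₁, b₂, hb₂, h1.trans hz.1, hz.2.trans h2⟩
    · rintro ⟨b, hb, -, -, h1, -⟩
      exact absurd ((hhull' b hb).trans_le h1) not_lt_bot
    · have hlt := hxy.lt
      constructor
      · rintro ⟨b₁, hb₁, b₂, hb₂, h1, h2⟩
        rcases h1.eq_or_lt with rfl | h1
        · exact ⟨y, (hBU hxy).1 hb₁, y, (hBU hxy).1 hb₁, le_rfl, le_rfl⟩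
        rcases le_total y b₂ with h3 | h3
        · exact ⟨b₁, hb₁, b₂, hb₂, h1.le.trans hlt.le, h3⟩
        -- An arc leaving the hull past `b₂` meets or crosses `(b₁, b₂)`, so its ends already belong
        -- to `B`.
        · have := (hU.rel (hBr hb₁ hb₂ (h1.trans_le h2)) hxy h1.le h2 h3).1 h1
          have hx := (hBU this).1 hb₁
          exact ⟨y, (hBU hxy).1 hx, y, (hBU hxy).1 hx, le_rfl, le_rfl⟩
      · rintro ⟨b₁, hb₁, b₂, hb₂, h1, h2⟩
        rcases h2.eq_or_lt with rfl | h2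
        · exact ⟨x, (hBU hxy).2 hb₂, x, (hBU hxy).2 hb₂, le_rfl, le_rfl⟩
        rcases le_total b₁ x with h3 | h3
        · exact ⟨b₁, hb₁, b₂, hb₂, h3, hlt.le.trans h2.le⟩
        · have := (hU.rel hxy (hBr hb₁ hb₂ (h1.trans_lt h2)) h3 h1 h2.le).2.2.1 h2
          have hx := (hBU hxy).2 ((hBU this).2 hb₂)
          exact ⟨x, hx, x, hx, le_rfl, le_rfl⟩
    · intro hiff
      obtain ⟨b, hb, -, -, h1, -⟩ := hiff.2 ⟨q, hqB, q, hqB, le_rfl, le_rfl⟩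
      exact absurd (hhull' b hb) (not_lt.2 h1)

/-- Intervals of integers are exhausted by half-open bounded intervals. -/
theorem exists_Ico_eventually (I : Set ℤ) (hI : I.OrdConnected) :
    ∃ v u : ℕ → ℤ, (∀ j, v j ≤ u j) ∧
      ∀ x, ∀ᶠ j in Filter.atTop, x ∈ Set.Ico (v j) (u j) ↔ x ∈ I := by
  -- Cut `I` with `[-j, j]`: a nonempty piece is `[inf, sup + 1)`, and `[0, 0)` stands for an empty
  -- one.
  have key : ∀ j : ℕ, ∃ v u : ℤ, v ≤ u ∧ I ∩ Set.Icc (-j : ℤ) j = Set.Ico v u := fun j ↦ by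
    rcases (I ∩ Set.Icc (-j : ℤ) j).eq_empty_or_nonempty with h | h
    · exact ⟨0, 0, le_rfl, by simp [h]⟩
    · have hbb : BddBelow (I ∩ Set.Icc (-j : ℤ) j) := bddBelow_Icc.mono Set.inter_subset_right
      have hba : BddAbove (I ∩ Set.Icc (-j : ℤ) j) := bddAbove_Icc.mono Set.inter_subset_right
      refine ⟨sInf (I ∩ Set.Icc (-j : ℤ) j), sSup (I ∩ Set.Icc (-j : ℤ) j) + 1, ?_, ?_⟩
      · exact (csInf_le_csSup h hbb hba).trans (by lia)
      · ext x
        refine ⟨fun hx ↦ ⟨csInf_le hbb hx, Int.lt_add_one_iff.2 (le_csSup hba hx)⟩, fun hx ↦ ?_⟩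
        exact (hI.inter Set.ordConnected_Icc).out (Int.csInf_mem h hbb) (Int.csSup_mem h hba)
          ⟨hx.1, Int.lt_add_one_iff.1 hx.2⟩
  choose v u hvu h using key
  refine ⟨v, u, hvu, fun x ↦ ?_⟩
  filter_upwards [Filter.eventually_ge_atTop x.natAbs] with j hj
  rw [← h j]
  exact and_iff_left ⟨by lia, by lia⟩

/-- The displayed equivalence says that `[v j, u j)` does not separate the two endpoints. For fixed
endpoints, membership in `[v j, u j)` eventually agrees with membership in the separating interval
`J`. -/
theorem IsSaturated.exists_test (hU : IsSaturated U) (hpq : p < q) (h : ¬ Rel U p q) :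
    ∃ v u : ℕ → ℤ, (∀ j, v j ≤ u j) ∧
      (∀ x y, Rel U x y → ∀ᶠ j in Filter.atTop,
        ((x < u j ∧ u j ≤ y) ↔ (x < v j ∧ v j ≤ y))) ∧
      ¬ ∀ᶠ j in Filter.atTop, ((p < u j ∧ u j ≤ q) ↔ (p < v j ∧ v j ≤ q)) := by
  obtain ⟨J, hJ, hbot, hJU, hJpq⟩ := hU.exists_ordConnected hpq h
  obtain ⟨v, u, hvu, hI⟩ := exists_Ico_eventually (((↑) : ℤ → WithBot ℤ) ⁻¹' J)
    (hJ.preimage_mono fun a b hab ↦ WithBot.coe_le_coe.2 hab)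
  have hI' : ∀ x : WithBot ℤ, ∀ᶠ j in Filter.atTop, ((v j ≤ x ∧ x < u j) ↔ x ∈ J) := by
    intro x
    induction x using WithBot.recBotCoe with
    -- No interval `[v j, u j)` contains `-∞`; this is why `⊥ ∉ J` is required.
    | bot => exact .of_forall fun j ↦ ⟨fun h ↦ absurd h.1 (by simp), fun h ↦ absurd h hbot⟩
    | coe x =>
      refine (hI x).mono fun j hj ↦ ?_
      rw [WithBot.coe_le_coe, WithBot.coe_lt_coe]
      exact hj
  have haux : ∀ {v u x y : WithBot ℤ}, v ≤ u → x < y →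
      (((x < u ∧ u ≤ y) ↔ (x < v ∧ v ≤ y)) ↔ ((v ≤ x ∧ x < u) ↔ (v ≤ y ∧ y < u))) := by
    intro v u x y h1 h2
    grind
  refine ⟨v, u, hvu, fun x y hxy ↦ ?_, fun hcon ↦ hJpq ?_⟩
  · filter_upwards [hI' x, hI' y] with j hx hy
    rw [haux (WithBot.coe_le_coe.2 (hvu j)) hxy.lt, hx, hy]
    exact hJU x y hxy
  · obtain ⟨j, hj, hx, hy⟩ := (hcon.and ((hI' p).and (hI' q))).exists
    rwa [haux (WithBot.coe_le_coe.2 (hvu j)) hpq, hx, hy] at hj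

end Arc

variable {k : Type u} [Field k]

/-- An arc outside a saturated set is separated from it by one of the test subcategories. -/
theorem exists_test_of_notMem {U : Set Arc} (hU : Arc.IsSaturated U) {β : Arc} (hβ : β ∉ U) :
    ∃ f : ℕ → ℤ × ℕ, (∀ α ∈ U, test k f (stalk (α.grMod k))) ∧
      ¬ test k f (stalk (β.grMod k)) := by
  obtain ⟨v, u, hvu, h₁, h₂⟩ := hU.exists_test β.lt (fun h ↦ hβ h.2)
  have hf : ∀ j, -(-u j + ((u j - v j).toNat : ℤ)) = v j := fun j ↦ by have := hvu j; lia
  -- The power `y^(u-v)` goes from degree `-u` to degree `-v`.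
  refine ⟨fun j ↦ (-u j, (u j - v j).toNat), fun α hα ↦ ?_, ?_⟩
  · rw [test_stalk_iff]
    simpa only [hf, neg_neg] using h₁ α.src α.tgt ⟨α.lt, hα⟩
  · rw [test_stalk_iff]
    simpa only [hf, neg_neg] using h₂

end ArcModel

namespace ArcModel

/-! ### Thick subcategories and saturated sets -/

section

variable {T : Type u} [Category.{v} T] [HasZeroObject T] [HasShift T ℤ] [Preadditive T]
  [∀ n : ℤ, (shiftFunctor T n).Additive] [Pretriangulated T]

instance (P : Thick T) : P.prop.IsTriangulated := P.isTriangulated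

instance (P : Thick T) : P.prop.IsStableUnderRetracts := P.isStableUnderRetracts

theorem add_le {P Q : ObjectProperty T} [Q.IsTriangulated] [Q.IsStableUnderRetracts]
    (h : P ≤ Q) : add P ≤ Q := by
  rintro X ⟨n, Y, hY, ⟨r⟩⟩
  exact Q.prop_of_retract (r.trans (Retract.ofIso (biproduct.isoProduct Y)))
    (Q.prop_pi Y fun j ↦ h _ (hY j))

/-- A distinguished triangle whose vertices lie in a triangulated subcategory is distinguished
in that subcategory. -/
theorem distinguished_fullSubcategory (P : ObjectProperty T) [P.IsTriangulated]
    {X₁ X₂ X₃ : P.FullSubcategory} {f : X₁.obj ⟶ X₂.obj} {g : X₂.obj ⟶ X₃.obj}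
    {h : X₃.obj ⟶ X₁.obj⟦(1 : ℤ)⟧} (hT : Triangle.mk f g h ∈ distTriang T) :
    Triangle.mk (ObjectProperty.homMk f) (ObjectProperty.homMk g)
      (ObjectProperty.homMk (h ≫ (P.ι.commShiftIso (1 : ℤ)).inv.app X₁)) ∈
        distTriang P.FullSubcategory := by
  refine isomorphic_distinguished _ hT _
    (Triangle.isoMk _ _ (Iso.refl _) (Iso.refl _) (Iso.refl _) ?_ ?_ ?_)
  · exact (Category.comp_id _).trans (Category.id_comp _).symm
  · exact (Category.comp_id _).trans (Category.id_comp _).symm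
  · change ((h ≫ (P.ι.commShiftIso (1 : ℤ)).inv.app X₁) ≫
      (P.ι.commShiftIso (1 : ℤ)).hom.app X₁) ≫ (𝟙 X₁.obj)⟦(1 : ℤ)⟧' = 𝟙 X₃.obj ≫ h
    refine (congrArg (_ ≫ ·) ((shiftFunctor T (1 : ℤ)).map_id X₁.obj)).trans ?_
    refine (Category.comp_id _).trans ((Category.assoc _ _ _).trans ?_)
    refine (congrArg (h ≫ ·) (Iso.inv_hom_id_app (P.ι.commShiftIso (1 : ℤ)) X₁)).trans ?_
    exact (Category.comp_id _).trans (Category.id_comp _).symm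

end

variable {k : Type u} [Field k]

theorem tau_le {U : Set Arc} {Q : ObjectProperty (Db k)} [Q.IsTriangulated]
    [Q.IsStableUnderRetracts] (h : ∀ α ∈ U, Q (stalk (α.grMod k))) : tau k U ≤ Q :=
  add_le (by
    rintro _ ⟨l, α, hα, rfl⟩
    exact Q.le_shift l _ (h α hα))

theorem tau_mono {U V : Set Arc} (h : U ⊆ V) : tau k U ≤ tau k V := by
  rintro X ⟨n, Y, hY, r⟩
  exact ⟨n, Y, fun i ↦ (hY i).imp fun l ↦ fun ⟨α, hα, e⟩ ↦ ⟨α, h hα, e⟩, r⟩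

/-- One inclusion is closure under shifts, sums and summands, the other is the decomposition of
complexes. -/
theorem tau_sigma (Q : ObjectProperty (Db k)) [Q.IsTriangulated] [Q.IsStableUnderRetracts] :
    tau k (sigma k Q) = Q :=
  le_antisymm (tau_le fun _ hα ↦ hα) fun X hX ↦ decomposes X Q hX

/-- A short exact sequence of graded modules gives a distinguished triangle in `D^b(gr S)`. -/
theorem exists_distinguished_of_shortExact {S : ShortComplex (GrMod k)} (hS : S.ShortExact) :
    ∃ h : stalk S.X₃ ⟶ (stalk S.X₁)⟦(1 : ℤ)⟧,
      Triangle.mk ((stalkFunctor k).map S.f) ((stalkFunctor k).map S.g) h ∈ distTriang (Db k) := by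
  exact ⟨_, distinguished_fullSubcategory _ hS.singleTriangle_distinguished⟩

section

variable (Q : ObjectProperty (Db k)) [Q.IsTriangulated] [Q.IsStableUnderRetracts]

theorem stalk_mem_of_shortExact {S : ShortComplex (GrMod k)} (hS : S.ShortExact) :
    (Q (stalk S.X₂) → Q (stalk S.X₃) → Q (stalk S.X₁)) ∧
    (Q (stalk S.X₁) → Q (stalk S.X₃) → Q (stalk S.X₂)) ∧
    (Q (stalk S.X₁) → Q (stalk S.X₂) → Q (stalk S.X₃)) := by
  obtain ⟨h, hT⟩ := exists_distinguished_of_shortExact hS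
  exact ⟨fun h₂ h₃ ↦ Q.ext_of_isTriangulatedClosed₁ _ hT h₂ h₃,
    fun h₁ h₃ ↦ Q.ext_of_isTriangulatedClosed₂ _ hT h₁ h₃,
    fun h₁ h₂ ↦ Q.ext_of_isTriangulatedClosed₃ _ hT h₁ h₂⟩

/-- When endpoints coincide, two-out-of-three for concatenated arcs suffices. For crossing arcs,
`(c, b)` and `(a, d)` are summands of an extension, and then two-out-of-three gives `(a, c)` and
`(b, d)`. -/
theorem isSaturated_sigma : Arc.IsSaturated (sigma k Q) := by
  have tri : ∀ {a c b : WithBot ℤ} (hac : a < c) (hcb : c < b),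
      ((⟨a, b, hac.trans hcb⟩ : Arc) ∈ sigma k Q → (⟨c, b, hcb⟩ : Arc) ∈ sigma k Q →
        (⟨a, c, hac⟩ : Arc) ∈ sigma k Q) ∧
      ((⟨a, c, hac⟩ : Arc) ∈ sigma k Q → (⟨c, b, hcb⟩ : Arc) ∈ sigma k Q →
        (⟨a, b, hac.trans hcb⟩ : Arc) ∈ sigma k Q) ∧
      ((⟨a, c, hac⟩ : Arc) ∈ sigma k Q → (⟨a, b, hac.trans hcb⟩ : Arc) ∈ sigma k Q →
        (⟨c, b, hcb⟩ : Arc) ∈ sigma k Q) := by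
    intro a c b hac hcb
    obtain ⟨f, g, w, hS⟩ := Arc.exists_shortExact_of_lt (k := k) hac hcb
    exact stalk_mem_of_shortExact Q hS
  intro a b c d hab hcd h₁ h₂ hac hcb hbd
  rcases hac.eq_or_lt with rfl | hac
  · exact ⟨fun h ↦ absurd h (lt_irrefl _), fun _ ↦ h₁, fun h ↦ (tri hab h).2.2 h₁ h₂, fun _ ↦ h₂⟩
  rcases hcb.eq_or_lt with rfl | hcb
  · exact ⟨fun _ ↦ h₁, fun h ↦ absurd h (lt_irrefl _), fun _ ↦ h₂, fun _ ↦ (tri hab hcd).2.1 h₁ h₂⟩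
  rcases hbd.eq_or_lt with rfl | hbd
  · exact ⟨fun h ↦ (tri h hcd).1 h₁ h₂, fun _ ↦ h₂, fun h ↦ absurd h (lt_irrefl _), fun _ ↦ h₁⟩
  obtain ⟨f, g, w, hS⟩ := Arc.exists_shortExact_prod_of_lt (k := k) hac hcb hbd
  have hprod := (stalk_mem_of_shortExact Q hS).2.1 h₁ h₂
  have hcb' : (⟨c, b, hcb⟩ : Arc) ∈ sigma k Q := by
    refine Q.prop_of_retract (Retract.map (F := stalkFunctor k) ?_) hprod
    exact ⟨GrMod.ofLin (LinearMap.inl k[X] _ _) (fun i _ hm ↦ ⟨hm, zero_mem (GrMod.grading _ i)⟩),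
      GrMod.ofLin (LinearMap.fst k[X] _ _) (fun _ _ hm ↦ hm.1), rfl⟩
  have had' : (⟨a, d, (hac.trans hcb).trans hbd⟩ : Arc) ∈ sigma k Q := by
    refine Q.prop_of_retract (Retract.map (F := stalkFunctor k) ?_) hprod
    exact ⟨GrMod.ofLin (LinearMap.inr k[X] _ _) (fun i _ hm ↦ ⟨zero_mem (GrMod.grading _ i), hm⟩),
      GrMod.ofLin (LinearMap.snd k[X] _ _) (fun _ _ hm ↦ hm.2), rfl⟩
  exact ⟨fun _ ↦ (tri hac hcb).1 h₁ hcb', fun _ ↦ hcb', fun _ ↦ (tri hab hbd).2.2 h₁ had',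
    fun _ ↦ had'⟩

end

/-- The thick subcategory given by a test. -/
def testThick (f : ℕ → ℤ × ℕ) : Thick (Db k) := ⟨test k f, inferInstance, inferInstance⟩

variable (k) in
/-- The thick subcategory attached to a saturated set of arcs. -/
def thickOfSat (U : Sat) : Thick (Db k) :=
  sInf {P | ∃ f : ℕ → ℤ × ℕ, P = testThick f ∧ ∀ α ∈ U.arcs, test k f (stalk (α.grMod k))}

theorem thickOfSat_prop_iff (U : Sat) (X : Db k) : (thickOfSat k U).prop X ↔
    ∀ f : ℕ → ℤ × ℕ, (∀ α ∈ U.arcs, test k f (stalk (α.grMod k))) → test k f X :=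
  ⟨fun h f hf ↦ h _ ⟨f, rfl, hf⟩, by
    rintro h _ ⟨f, rfl, hf⟩
    exact h f hf⟩

/-- Every arc outside `U` fails some test that all of `U` passes. -/
theorem sigma_thickOfSat (U : Sat) : sigma k (thickOfSat k U).prop = U.arcs := by
  ext β
  refine ⟨fun hβ ↦ ?_, fun hβ ↦ (thickOfSat_prop_iff U _).2 fun f hf ↦ hf β hβ⟩
  by_contra hcon
  obtain ⟨f, hf, hf'⟩ := exists_test_of_notMem (k := k) U.isSaturated hcon
  exact hf' ((thickOfSat_prop_iff U _).1 hβ f hf)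

/-- This is where thickness of `tau k U.arcs` comes from: a thick subcategory is `tau` of its arcs,
and here these are `U`. -/
theorem thickOfSat_prop (U : Sat) : (thickOfSat k U).prop = tau k U.arcs := by
  rw [← tau_sigma (thickOfSat k U).prop, sigma_thickOfSat]

variable (k) in
/-- Saturated sets of arcs correspond to thick subcategories of `D^b(gr S)`. -/
def satEquivThick : Sat ≃o Thick (Db k) where
  toFun := thickOfSat k
  invFun P := ⟨sigma k P.prop, isSaturated_sigma P.prop⟩
  left_inv U := Sat.ext (sigma_thickOfSat U)
  right_inv P := Thick.ext (by rw [thickOfSat_prop, tau_sigma])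
  map_rel_iff' {U V} := by
    refine ⟨fun h ↦ ?_, fun h ↦ ?_⟩
    · change U.arcs ⊆ V.arcs
      rw [← sigma_thickOfSat (k := k) U, ← sigma_thickOfSat (k := k) V]
      exact fun α hα ↦ h _ hα
    · change (thickOfSat k U).prop ≤ (thickOfSat k V).prop
      rw [thickOfSat_prop, thickOfSat_prop]
      exact tau_mono h

theorem satEquivThick_prop (U : Sat) : (satEquivThick k U).prop = tau k U.arcs :=
  thickOfSat_prop U

theorem satEquivThick_symm_arcs (P : Thick (Db k)) :
    ((satEquivThick k).symm P).arcs = sigma k P.prop := rfl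

/-! ### Torsion complexes -/

instance : (torsion k).IsStableUnderRetracts where
  of_retract {X Y} r hY n :=
    (hY n).of_surjective (f := GrMod.toLin ((DerivedCategory.homologyFunctor (GrMod k) n).map
      (DerivedCategory.Bounded.ι.map r.r))) fun m ↦
        ⟨GrMod.toLin (((r.map DerivedCategory.Bounded.ι).map
          (DerivedCategory.homologyFunctor (GrMod k) n)).i) m, by
            rw [← GrMod.toLin_comp]
            exact congrArg (fun g ↦ GrMod.toLin g m) ((r.map DerivedCategory.Bounded.ι).map
              (DerivedCategory.homologyFunctor (GrMod k) n)).retract⟩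

theorem torsion_stalk_iff_isFiniteLength (M : GrMod k) :
    torsion k (stalk M) ↔ IsFiniteLength k[X] M := by
  refine ⟨fun h ↦ isFiniteLength_of_iso k (homologyStalkIso M) (h 0), fun h n ↦ ?_⟩
  by_cases hn : n = 0
  · subst hn
    exact isFiniteLength_of_iso k (homologyStalkIso M).symm h
  · have h0 := GrMod.isZero_iff_forall_eq_zero.1 (isZero_homology_stalk M hn)
    have : Subsingleton ((DerivedCategory.homologyFunctor (GrMod k) n).obj (stalk M).obj) :=
      ⟨fun x y ↦ (h0 x).trans (h0 y).symm⟩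
    exact .of_subsingleton

theorem isFiniteLength_quotient_X_pow (n : ℕ) :
    IsFiniteLength k[X] (k[X] ⧸ Ideal.span {(Polynomial.X : k[X]) ^ n}) := by
  have : Module.Finite k (k[X] ⧸ Ideal.span {(Polynomial.X : k[X]) ^ n}) :=
    (Polynomial.monic_X_pow n).finite_quotient
  rw [isFiniteLength_iff_isNoetherian_isArtinian]
  exact ⟨inferInstance, isArtinian_of_tower k inferInstance⟩

theorem not_isFiniteLength_polynomial : ¬ IsFiniteLength k[X] k[X] := fun h ↦ by
  have : IsArtinianRing k[X] := (isFiniteLength_iff_isNoetherian_isArtinian.1 h).2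
  exact Polynomial.not_isField k (IsArtinianRing.isField_of_isDomain k[X])

theorem isFiniteLength_grMod_iff (α : Arc) : IsFiniteLength k[X] (α.grMod k) ↔ α.src ≠ ⊥ := by
  obtain ⟨src, tgt, lt⟩ := α
  induction src using WithBot.recBotCoe with
  | bot => exact iff_of_false not_isFiniteLength_polynomial fun h ↦ h rfl
  | coe a => exact iff_of_true (isFiniteLength_quotient_X_pow _) WithBot.coe_ne_bot

theorem sigma_torsion : sigma k (torsion k) = Sat.finiteArcs.arcs := by
  ext α
  exact (torsion_stalk_iff_isFiniteLength _).trans (isFiniteLength_grMod_iff α)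

theorem tau_le_torsion {U : Sat} (hU : U ≤ Sat.finiteArcs) : tau k U.arcs ≤ torsion k :=
  tau_le fun α hα ↦ by
    have : α ∈ sigma k (torsion k) := by
      rw [sigma_torsion]
      exact hU hα
    exact this

/-- Both properties are closed under isomorphism, so the essential image can be tested on the object
itself. -/
theorem map_ι_torsion_iff (P : Thick (DbTors k)) (X : Db k) :
    P.prop.map (torsion k).ι X ↔ ∃ h : torsion k X, P.prop ⟨X, h⟩ := by
  constructor
  · rintro ⟨Y, hY, ⟨e⟩⟩
    exact ⟨(torsion k).prop_of_iso e Y.property,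
      P.prop.prop_of_iso (ObjectProperty.isoMk _ e) hY⟩
  · rintro ⟨h, hX⟩
    exact ⟨_, hX, ⟨Iso.refl _⟩⟩

/-- The essential image in `D^b(gr S)` of a thick subcategory of torsion complexes. -/
def thickMap (P : Thick (DbTors k)) : Thick (Db k) where
  prop := P.prop.map (torsion k).ι
  isTriangulated :=
    { exists_zero := by
        obtain ⟨Z, hZ, hPZ⟩ := P.prop.exists_prop_of_containsZero
        exact ⟨_, Functor.map_isZero (torsion k).ι hZ, P.prop.prop_map_obj _ hPZ⟩
      isStableUnderShiftBy := fun n ↦ ⟨by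
        rintro X ⟨Y, hY, ⟨e⟩⟩
        exact ⟨Y⟦n⟧, P.prop.le_shift n _ hY,
          ⟨((torsion k).ι.commShiftIso n).app Y ≪≫ (shiftFunctor (Db k) n).mapIso e⟩⟩⟩
      ext₂' := by
        intro D hD h₁ h₃
        obtain ⟨t₁, p₁⟩ := (map_ι_torsion_iff P _).1 h₁
        obtain ⟨t₃, p₃⟩ := (map_ι_torsion_iff P _).1 h₃
        -- The middle vertex is torsion, so the whole triangle lives in the torsion subcategory,
        -- where `P` is closed under extensions.
        have t₂ := (torsion k).ext_of_isTriangulatedClosed₂ D hD t₁ t₃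
        exact ObjectProperty.le_isoClosure _ _ ((map_ι_torsion_iff P _).2
          ⟨t₂, P.prop.ext_of_isTriangulatedClosed₂ _ (distinguished_fullSubcategory (torsion k)
            (X₁ := ⟨_, t₁⟩) (X₂ := ⟨_, t₂⟩) (X₃ := ⟨_, t₃⟩) hD) p₁ p₃⟩) }
  isStableUnderRetracts := ⟨by
    rintro X Y r h
    obtain ⟨hY, h⟩ := (map_ι_torsion_iff P _).1 h
    refine (map_ι_torsion_iff P _).2 ⟨(torsion k).prop_of_retract r hY, ?_⟩
    exact P.prop.prop_of_retract (Y := ⟨Y, hY⟩)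
      ⟨ObjectProperty.homMk r.i, ObjectProperty.homMk r.r, (torsion k).ι.map_injective r.retract⟩ h⟩

/-- The torsion complexes in a thick subcategory. -/
def thickComap (P : Thick (Db k)) : Thick (DbTors k) where
  prop := P.prop.inverseImage (torsion k).ι
  isTriangulated := inferInstance
  isStableUnderRetracts := ⟨fun r h ↦ P.prop.prop_of_retract (r.map (torsion k).ι) h⟩

theorem thickComap_thickMap (P : Thick (DbTors k)) : thickComap (thickMap P) = P := by
  refine Thick.ext ?_
  ext X
  exact (map_ι_torsion_iff P X.obj).trans ⟨fun h ↦ h.2, fun h ↦ ⟨X.property, h⟩⟩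

theorem thickMap_thickComap {P : Thick (Db k)} (hP : P.prop ≤ torsion k) :
    thickMap (thickComap P) = P := by
  refine Thick.ext ?_
  ext X
  exact (map_ι_torsion_iff _ X).trans ⟨fun h ↦ h.2, fun h ↦ ⟨hP X h, h⟩⟩

theorem thickMap_le_torsion (P : Thick (DbTors k)) : (thickMap P).prop ≤ torsion k :=
  fun X hX ↦ ((map_ι_torsion_iff P X).1 hX).1

theorem satEquivThick_le_torsion {U : Sat} (hU : U ≤ Sat.finiteArcs) :
    (satEquivThick k U).prop ≤ torsion k := by
  rw [satEquivThick_prop]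
  exact tau_le_torsion hU

theorem satEquivThick_symm_le {P : Thick (Db k)} (hP : P.prop ≤ torsion k) :
    (satEquivThick k).symm P ≤ Sat.finiteArcs := by
  change sigma k P.prop ⊆ Sat.finiteArcs.arcs
  rw [← sigma_torsion (k := k)]
  exact fun α hα ↦ hP _ hα

variable (k) in
/-- Saturated sets of arcs of finite length correspond to thick subcategories of
`D^b_tors(gr S)`. -/
def satFiniteEquivThick : SatFinite ≃o Thick (DbTors k) where
  toFun U := thickComap (satEquivThick k U.1)
  invFun P := ⟨(satEquivThick k).symm (thickMap P), satEquivThick_symm_le (thickMap_le_torsion P)⟩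
  left_inv U := Subtype.ext ((congrArg (satEquivThick k).symm
    (thickMap_thickComap (satEquivThick_le_torsion U.2))).trans
      ((satEquivThick k).symm_apply_apply U.1))
  right_inv P := (congrArg thickComap ((satEquivThick k).apply_symm_apply (thickMap P))).trans
    (thickComap_thickMap P)
  map_rel_iff' {U V} := by
    refine Iff.trans ?_ (satEquivThick k).map_rel_iff
    refine ⟨fun h ↦ fun X hX ↦ ?_, fun h X hX ↦ h X.obj hX⟩
    exact h ⟨X, satEquivThick_le_torsion U.2 X hX⟩ hX

end ArcModel
end

open ArcModel in
theorem mainTheorem2 (k : Type u) [Field k] :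
    ∃ e : Sat ≃o Thick (Db k),
      (∀ U : Sat, (e U).prop = tau k U.arcs) ∧
      (∀ P : Thick (Db k), (e.symm P).arcs = sigma k P.prop) ∧
      ∃ ef : SatFinite ≃o Thick (DbTors k),
        (∀ U : SatFinite, (ef U).prop.map (torsion k).ι = tau k U.1.arcs) ∧
        (∀ P : Thick (DbTors k),
          (ef.symm P).1.arcs = sigma k (P.prop.map (torsion k).ι)) := by
  refine ⟨satEquivThick k, satEquivThick_prop, satEquivThick_symm_arcs, satFiniteEquivThick k,
    fun U ↦ ?_, fun P ↦ rfl⟩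
  rw [← satEquivThick_prop]
  exact congrArg Thick.prop (thickMap_thickComap (satEquivThick_le_torsion U.2))
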